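/- Let $n\ge 2$, $p>1$, $0<c_1\le c_2<+\infty$, and let $W\colon\mathbb R\to[0,+\infty)$ be continuous with $W(t)=0$ if and only if $t\in\{0,1\}$. Let $(\varepsilon_k)\subset(0,1]$ be a decreasing sequence with $\varepsilon_k\to0$, and for every $k\in\mathbb N$ let $f_k\colon\mathbb R^n\times\mathbb R\times\mathbb R^n\to[0,+\infty)$ be a Borel function with $$c_1\big(W(u)+|\xi|^p\big)\le f_k(x,u,\xi)\le c_2\big(W(u)+|\xi|^p\big)\qquad\text{for all }x\in\mathbb R^n,\ u\in\mathbb R,\ \xi\in\mathbb R^n .$$ Let $\mathbb S^{n-1}$ be the unit sphere of $\mathbb R^n$, let $\widehat{\mathbb S}^{n-1}_{\pm}$ be the set of those $\nu\in\mathbb S^{n-1}$ whose last nonzero coordinate is positive (for $+$), respectively negative (for $-$), and let $Q=(-\tfrac12,\tfrac12)^n$. For every $\nu\in\mathbb S^{n-1}$ let $R_\nu$ be an orthogonal $n\times n$ matrix with $R_\nu e_n=\nu$ such that $R_{-\nu}Q=R_\nu Q$, such that $R_\nu$ has rational entries if $\nu\in\mathbb Q^n$, and such that $\nu\mapsto R_\nu$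 is continuous on $\widehat{\mathbb S}^{n-1}_+$ and on $\widehat{\mathbb S}^{n-1}_-$. Put $Q^\nu_\rho(x):=x+\rho R_\nu Q$. Let ${\rm u}\in C^1(\mathbb R)$ satisfy $0\le{\rm u}\le1$, ${\rm u}(t)=0$ for $t<-1$ and ${\rm u}(t)=1$ for $t>1$, and put $\bar u^\nu_{x,\varepsilon}(y):={\rm u}\big(\tfrac1\varepsilon(y-x)\cdot\nu\big)$. For $x\in\mathbb R^n$, $\nu\in\mathbb S^{n-1}$ and $\rho>0$ let $$\mathbf m_k\big(\bar u^\nu_{x,\varepsilon_k},Q^\nu_\rho(x)\big):=\inf\Big\{\frac1{\varepsilon_k}\int_{Q^\nu_\rho(x)}f_k(y,u,\varepsilon_k\nabla u)\,dy\Big\},$$ where the infimum is over all $u\in W^{1,p}(Q^\nu_\rho(x))$ with $0\le u\le1$ a.e. that agree a.e. with $\bar u^\nu_{x,\varepsilon_k}$ in a neighbourhood of $\partial Q^\nu_\rho(x)$ (inside $Q^\nu_\rho(x)$), and let $$f'(x,\nu):=\limsup_{\rho\to0^+}\frac1{\rho^{n-1}}\liminf_{k\to+\infty}\mathbf m_k\big(\bar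 u^\nu_{x,\varepsilon_k},Q^\nu_\rho(x)\big),\qquad f''(x,\nu):=\limsup_{\rho\to0^+}\frac1{\rho^{n-1}}\limsup_{k\to+\infty}\mathbf m_k\big(\bar u^\nu_{x,\varepsilon_k},Q^\nu_\rho(x)\big).$$ Then $f'$ and $f''$ are Borel measurable on $\mathbb R^n\times\mathbb S^{n-1}$, and for every $x\in\mathbb R^n$ and every $\nu\in\mathbb S^{n-1}$ $$c_1c_p\le f'(x,\nu)\le c_2c_p,\qquad c_1c_p\le f''(x,\nu)\le c_2c_p,\qquad\text{where}\quad c_p:=p\,(p-1)^{\frac{1-p}p}\int_0^1W(t)^{\frac{p-1}p}\,dt .$$ -/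

import Mathlib

open MeasureTheory Filter Topology
open scoped ENNReal ContDiff

noncomputable section

namespace PhaseTransition

/-- The space `ℝⁿ` with its Euclidean norm. -/
abbrev E (n : ℕ) : Type := EuclideanSpace ℝ (Fin n)

/-- The unit sphere `𝕊ⁿ⁻¹` of `ℝⁿ`. -/
abbrev S (n : ℕ) : Type := Metric.sphere (0 : E n) 1

/-! ### Directions, rotations and cubes -/

/-- The last vector `e_n` of the standard basis of `ℝⁿ`. -/
def lastVec (n : ℕ) : E n := WithLp.toLp 2 fun i => if (i : ℕ) + 1 = n then 1 else 0

/-- The unit vectors whose last nonzero coordinate is positive. -/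
def hemispherePos (n : ℕ) : Set (S n) :=
  {ν | ∃ i : Fin n, 0 < (ν : E n) i ∧ ∀ j : Fin n, i < j → (ν : E n) j = 0}

/-- The unit vectors whose last nonzero coordinate is negative. -/
def hemisphereNeg (n : ℕ) : Set (S n) :=
  {ν | ∃ i : Fin n, (ν : E n) i < 0 ∧ ∀ j : Fin n, i < j → (ν : E n) j = 0}

/-- The open unit cube centred at the origin, with sides parallel to the axes. -/
def unitCube (n : ℕ) : Set (E n) := {y | ∀ i, |y i| < 1 / 2}

/-- A choice `ν ↦ R_ν` of orthogonal matrices with `R_ν e_n = ν`, with `R_{-ν} Q = R_ν Q` for the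
unit cube `Q`, with rational entries for rational `ν`, and continuous on each of the two
half-spheres. -/
structure IsRotationFamily (n : ℕ) (R : S n → Matrix (Fin n) (Fin n) ℝ) : Prop where
  orthogonal : ∀ ν, R ν ∈ Matrix.orthogonalGroup (Fin n) ℝ
  map_lastVec : ∀ ν, Matrix.toEuclideanLin (R ν) (lastVec n) = (ν : E n)
  cube_neg : ∀ ν, Matrix.toEuclideanLin (R (-ν)) '' unitCube n =
    Matrix.toEuclideanLin (R ν) '' unitCube n
  rational : ∀ ν : S n, (∀ i, ∃ q : ℚ, (ν : E n) i = q) → ∀ i j, ∃ q : ℚ, R ν i j = q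
  continuousOn_pos : ContinuousOn R (hemispherePos n)
  continuousOn_neg : ContinuousOn R (hemisphereNeg n)

/-- The open cube `Q^ν_ρ(x)` with centre `x`, side length `ρ` and orientation `R_ν`. -/
def cube {n : ℕ} (R : S n → Matrix (Fin n) (Fin n) ℝ) (ν : S n) (ρ : ℝ) (x : E n) : Set (E n) :=
  (fun y => x + ρ • Matrix.toEuclideanLin (R ν) y) '' unitCube n

/-! ### Boundary datum -/

/-- A one-dimensional transition profile: `C¹`, with values in `[0,1]`, equal to the characteristic
function of `(0,∞)` outside `[-1,1]`. -/
structure IsProfile (w : ℝ → ℝ) : Prop where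
  contDiff : ContDiff ℝ 1 w
  mem_Icc : ∀ t, w t ∈ Set.Icc (0 : ℝ) 1
  eq_zero : ∀ t, t < -1 → w t = 0
  eq_one : ∀ t, 1 < t → w t = 1

/-- The function `y ↦ w ((y - x) ⬝ ν / ε)`. -/
def boundaryDatum {n : ℕ} (w : ℝ → ℝ) (ε : ℝ) (x : E n) (ν : S n) (y : E n) : ℝ :=
  w (1 / ε * inner ℝ (y - x) (ν : E n))

/-! ### Potentials and integrands -/

/-- A double-well potential: continuous, nonnegative, vanishing exactly at `0` and `1`. -/
structure IsDoubleWell (W : ℝ → ℝ) : Prop where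
  continuous : Continuous W
  nonneg : ∀ t, 0 ≤ W t
  eq_zero_iff : ∀ t, W t = 0 ↔ t = 0 ∨ t = 1

/-- The class of integrands `f(x, u, ξ)`: Borel functions with
`c₁ (W(u) + |ξ|ᵖ) ≤ f(x, u, ξ) ≤ c₂ (W(u) + |ξ|ᵖ)`. -/
structure IsIntegrand {n : ℕ} (W : ℝ → ℝ) (p c₁ c₂ : ℝ) (f : E n → ℝ → E n → ℝ) : Prop where
  measurable : Measurable fun z : E n × ℝ × E n => f z.1 z.2.1 z.2.2
  lower : ∀ x u ξ, c₁ * (W u + ‖ξ‖ ^ p) ≤ f x u ξ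
  upper : ∀ x u ξ, f x u ξ ≤ c₂ * (W u + ‖ξ‖ ^ p)

/-! ### Sobolev functions and energies -/

/-- `g` is the weak gradient of `u` in `A`, and both `u` and `g` are `p`-integrable on `A`;
that is, `u ∈ W^{1,p}(A)` and `∇u = g`. -/
structure HasSobolevGradient {n : ℕ} (p : ℝ) (A : Set (E n)) (u : E n → ℝ) (g : E n → E n) :
    Prop where
  memLp : MemLp u (ENNReal.ofReal p) (volume.restrict A)
  memLp_grad : MemLp g (ENNReal.ofReal p) (volume.restrict A)
  weak : ∀ φ : E n → ℝ, ContDiff ℝ ∞ φ → HasCompactSupport φ → tsupport φ ⊆ A → ∀ i : Fin n,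
    ∫ y in A, u y * fderiv ℝ φ y (EuclideanSpace.single i 1) = - ∫ y in A, g y i * φ y

/-- The Sobolev functions `u ∈ W^{1,p}(A)` with `0 ≤ u ≤ 1` almost everywhere in `A`. -/
def sobolevUnit {n : ℕ} (p : ℝ) (A : Set (E n)) : Set (E n → ℝ) :=
  {u | (∃ g, HasSobolevGradient p A u g) ∧ ∀ᵐ y ∂(volume.restrict A), u y ∈ Set.Icc (0 : ℝ) 1}

/-- The functional `(1/ε) ∫_A f(y, u, ε ∇u) dy` if `u ∈ W^{1,p}(A)` and `0 ≤ u ≤ 1`, and `+∞`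
otherwise. The infimum is only a way to insert the weak gradient: this is unique almost everywhere
on an open set `A`, see `energy_eq`, and the infimum of the empty family is `+∞`,
see `energy_eq_top`. -/
def energy {n : ℕ} (f : E n → ℝ → E n → ℝ) (ε p : ℝ) (u : E n → ℝ) (A : Set (E n)) : ℝ≥0∞ :=
  ⨅ (g : E n → E n) (_ : HasSobolevGradient p A u g) (_ : u ∈ sobolevUnit p A),
    ENNReal.ofReal (1 / ε) * ∫⁻ y in A, ENNReal.ofReal (f y (u y) (ε • g y))

theorem HasSobolevGradient.ae_unique {n : ℕ} {p : ℝ} (hp : 1 ≤ p) {A : Set (E n)} (hA : IsOpen A)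
    {u : E n → ℝ} {g h : E n → E n} (hg : HasSobolevGradient p A u g)
    (hh : HasSobolevGradient p A u h) : g =ᵐ[volume.restrict A] h := by
  have hp' : (1 : ℝ≥0∞) ≤ ENNReal.ofReal p := by
    rw [← ENNReal.ofReal_one]; exact ENNReal.ofReal_le_ofReal hp
  have key : ∀ i : Fin n, ∀ᵐ y ∂volume, y ∈ A → g y i - h y i = 0 := by
    intro i
    have li : ∀ {k : E n → E n}, HasSobolevGradient p A u k →
        LocallyIntegrable (fun y => k y i) (volume.restrict A) := by
      intro k hk
      have h1 : MemLp (fun y => k y i) (ENNReal.ofReal p) (volume.restrict A) :=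
        (EuclideanSpace.proj (𝕜 := ℝ) i).comp_memLp' hk.memLp_grad
      exact h1.locallyIntegrable hp'
    have int : ∀ {k : E n → E n}, HasSobolevGradient p A u k → ∀ φ : E n → ℝ, ContDiff ℝ ∞ φ →
        HasCompactSupport φ → Integrable (fun y => k y i * φ y) (volume.restrict A) := by
      intro k hk φ hφ hc
      have := (li hk).integrable_smul_left_of_hasCompactSupport hφ.continuous hc
      simpa [mul_comm] using this
    refine hA.ae_eq_zero_of_integral_contDiff_smul_eq_zero (f := fun y => g y i - h y i) ?_ ?_
    · have hl := (li hg).sub (li hh)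
      exact locallyIntegrableOn_of_locallyIntegrable_restrict hl
    · intro φ hφ hc hs
      have e1 := hg.weak φ hφ hc hs i
      have e2 := hh.weak φ hφ hc hs i
      have e3 : ∫ y in A, (g y i * φ y - h y i * φ y) = 0 := by
        rw [integral_sub (int hg φ hφ hc) (int hh φ hφ hc)]
        linarith
      rw [← setIntegral_eq_integral_of_forall_compl_eq_zero (s := A), ← e3]
      · congr 1
        ext y
        simp [smul_eq_mul]; ring
      · intro y hy
        have : φ y = 0 := image_eq_zero_of_notMem_tsupport fun hm => hy (hs hm)
        simp [this]
  have key' := ae_all_iff.2 key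
  rw [Filter.EventuallyEq, ae_restrict_iff' hA.measurableSet]
  filter_upwards [key'] with y hy hyA
  ext i
  exact sub_eq_zero.1 (hy i hyA)

theorem energy_eq {n : ℕ} (f : E n → ℝ → E n → ℝ) (ε : ℝ) {p : ℝ} (hp : 1 ≤ p) {A : Set (E n)}
    (hA : IsOpen A) {u : E n → ℝ} {g : E n → E n} (hg : HasSobolevGradient p A u g)
    (hu : ∀ᵐ y ∂(volume.restrict A), u y ∈ Set.Icc (0 : ℝ) 1) :
    energy f ε p u A =
      ENNReal.ofReal (1 / ε) * ∫⁻ y in A, ENNReal.ofReal (f y (u y) (ε • g y)) := by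
  refine le_antisymm (iInf_le_of_le g (iInf_le_of_le hg (iInf_le_of_le ⟨⟨g, hg⟩, hu⟩ le_rfl))) ?_
  refine le_iInf fun h => le_iInf fun hh => le_iInf fun _ => le_of_eq ?_
  congr 1
  refine lintegral_congr_ae ?_
  filter_upwards [hg.ae_unique hp hA hh] with y hy
  rw [hy]

theorem energy_eq_top {n : ℕ} (f : E n → ℝ → E n → ℝ) (ε p : ℝ) {A : Set (E n)} {u : E n → ℝ}
    (hu : u ∉ sobolevUnit p A) : energy f ε p u A = ⊤ := by
  simp [energy, hu]

/-- The competitors: `u ∈ W^{1,p}(A)` with `0 ≤ u ≤ 1` that agree with `v` in a neighbourhood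
of `∂A`. -/
def admissible {n : ℕ} (p : ℝ) (v : E n → ℝ) (A : Set (E n)) : Set (E n → ℝ) :=
  {u | u ∈ sobolevUnit p A ∧
    ∃ U : Set (E n), IsOpen U ∧ frontier A ⊆ U ∧ ∀ᵐ y ∂(volume.restrict (U ∩ A)), u y = v y}

/-- The minimal energy on `A` among the competitors with boundary datum `v`. -/
def minEnergy {n : ℕ} (f : E n → ℝ → E n → ℝ) (ε p : ℝ) (v : E n → ℝ) (A : Set (E n)) : ℝ≥0∞ :=
  ⨅ u ∈ admissible p v A, energy f ε p u A

/-! ### The cell formulas -/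

section CellFormula

variable {n : ℕ} (f : ℕ → E n → ℝ → E n → ℝ) (ε : ℕ → ℝ) (p : ℝ) (w : ℝ → ℝ)
  (R : S n → Matrix (Fin n) (Fin n) ℝ)

/-- The cell minimum on `Q^ν_ρ(x)` at stage `k`. -/
def cellMin (k : ℕ) (ρ : ℝ) (x : E n) (ν : S n) : ℝ≥0∞ :=
  minEnergy (f k) (ε k) p (boundaryDatum w (ε k) x ν) (cube R ν ρ x)

/-- `f'(x,ν) = limsup_{ρ → 0+} ρ^{1-n} liminf_{k → ∞} m_k(Q^ν_ρ(x))`. -/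
def fLower (x : E n) (ν : S n) : ℝ≥0∞ :=
  limsup (fun ρ : ℝ => ENNReal.ofReal (1 / ρ ^ (n - 1)) *
    liminf (fun k : ℕ => cellMin f ε p w R k ρ x ν) atTop) (𝓝[>] 0)

/-- `f''(x,ν) = limsup_{ρ → 0+} ρ^{1-n} limsup_{k → ∞} m_k(Q^ν_ρ(x))`. -/
def fUpper (x : E n) (ν : S n) : ℝ≥0∞ :=
  limsup (fun ρ : ℝ => ENNReal.ofReal (1 / ρ ^ (n - 1)) *
    limsup (fun k : ℕ => cellMin f ε p w R k ρ x ν) atTop) (𝓝[>] 0)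

end CellFormula

/-- The surface tension `c_p = p (p-1)^{(1-p)/p} ∫_0^1 W^{(p-1)/p}`. -/
def surfaceTension (W : ℝ → ℝ) (p : ℝ) : ℝ :=
  p * (p - 1) ^ ((1 - p) / p) * ∫ t in (0 : ℝ)..1, W t ^ ((p - 1) / p)

end PhaseTransition

end

/-!
The lower bound, the upper bound and the measurability have independent reasons.

*Lower bound.* Young's inequality in the sharp form `factor_mul_le` gives
`W(u) / ε + ε ^ (p - 1) |∇u| ^ p ≥ p (p - 1) ^ ((1 - p) / p) ∂_ν (Φ ∘ u)`, where `Φ` is a primitive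
of `W ^ ((p - 1) / p)`. The integral over a cube of the right-hand side depends only
on the boundary datum (`integral_comp_mul_inner_eq_zero`, proved by mollifying the difference
between the competitor and the datum), and for the datum it is the area of the cross-section times
`Φ 1 - Φ 0` (`integral_boundaryDatum`). Hence `le_minEnergy`, for every cube larger than the
transition layer.

*Upper bound.* The equation `v' = ((W(v) + η) / (p - 1)) ^ (1 / p)`, for which Young's inequality is
almost an equality, yields profiles with energy close to the surface tension
(`exists_almost_optimal_profile`). Such a profile, rescaled by `ε`, is interpolated with the
boundary datum near the boundary of the cube; both are constant on either side of a slab of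
thickness of order `ε`, so the interpolation costs only a multiple of the area of the interface near
the lateral boundary (`layer_energy_le`). This gives `exists_forall_minEnergy_le`.

*Measurability.* The same interpolation of data compares minimal energies on different cubes
(`minEnergy_le_of_interpolate`). For fixed `ε` and fixed size of the cube it shows that the minimal
energy is upper semicontinuous in the centre and the direction, on each half-sphere where the
orientation of the cube is continuous (`upperSemicontinuous_minEnergy`), hence Borel. For concentric
cubes it shows that the minimal energy grows with the size `ρ` at most like a multiple of
`ρ ^ (n - 1)`, uniformly for small `ε` (`exists_minEnergy_cube_le`); therefore the upper limit as
`ρ → 0⁺` can be taken along rational `ρ` (`limsup_nhdsGT_eq_iInf_iSup_rat`).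
-/

noncomputable section

namespace PhaseTransition

/-! ### Geometry of the rotated cubes -/

/-- The supremum norm of the coordinates of `z` in the orthonormal frame formed by the columns of
`B`. The cubes are its balls, see `cube_eq`. -/
def cubeNorm {n : ℕ} (B : Matrix (Fin n) (Fin n) ℝ) (z : E n) : ℝ :=
  ‖(Matrix.mulVec B.transpose (WithLp.ofLp z) : Fin n → ℝ)‖

theorem continuous_cubeNorm {X : Type*} [TopologicalSpace X] {n : ℕ}
    {B : X → Matrix (Fin n) (Fin n) ℝ} {z : X → E n} (hB : Continuous B) (hz : Continuous z) :
    Continuous fun a => cubeNorm (B a) (z a) := by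
  unfold cubeNorm
  fun_prop

/-- The coordinates with respect to the frame formed by the columns of the orthogonal matrix `B`,
with origin `x`. -/
def cubeChart {n : ℕ} {B : Matrix (Fin n) (Fin n) ℝ} (hB : B ∈ Matrix.orthogonalGroup (Fin n) ℝ)
    (x : E n) : E n ≃ₜ (Fin n → ℝ) where
  toFun y := Matrix.mulVec B.transpose (WithLp.ofLp (y - x))
  invFun a := x + WithLp.toLp 2 (Matrix.mulVec B a)
  left_inv y := by
    have h : B * B.transpose = 1 := (Matrix.mem_orthogonalGroup_iff (Fin n) ℝ).1 hB
    simp [Matrix.mulVec_mulVec, h]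
  right_inv a := by
    have h : B.transpose * B = 1 := (Matrix.mem_orthogonalGroup_iff' (Fin n) ℝ).1 hB
    simp [Matrix.mulVec_mulVec, h]
  continuous_toFun := by fun_prop
  continuous_invFun := by fun_prop

theorem norm_cubeChart {n : ℕ} {B : Matrix (Fin n) (Fin n) ℝ}
    (hB : B ∈ Matrix.orthogonalGroup (Fin n) ℝ) (x y : E n) :
    ‖cubeChart hB x y‖ = cubeNorm B (y - x) := rfl

theorem measurePreserving_cubeChart {n : ℕ} {B : Matrix (Fin n) (Fin n) ℝ}
    (hB : B ∈ Matrix.orthogonalGroup (Fin n) ℝ) (x : E n) :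
    MeasurePreserving (cubeChart hB x) := by
  have hdet : |B.transpose.det| = 1 := by
    have h : B * B.transpose = 1 := (Matrix.mem_orthogonalGroup_iff (Fin n) ℝ).1 hB
    have h2 := congrArg Matrix.det h
    rw [Matrix.det_mul, Matrix.det_transpose, Matrix.det_one] at h2
    rw [Matrix.det_transpose]
    rcases mul_self_eq_one_iff.1 h2 with h | h <;> simp [h]
  have h0 : B.transpose.det ≠ 0 := fun h => by simp [h] at hdet
  have h1 : MeasurePreserving (fun y : E n => y - x) := measurePreserving_sub_right volume x
  have h2 : MeasurePreserving (@WithLp.ofLp 2 (Fin n → ℝ)) := PiLp.volume_preserving_ofLp (Fin n)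
  have h3 : MeasurePreserving (Matrix.toLin' B.transpose) := by
    refine ⟨(LinearMap.continuous_of_finiteDimensional _).measurable, ?_⟩
    rw [Real.map_matrix_volume_pi_eq_smul_volume_pi h0, abs_inv, hdet]
    simp
  exact h3.comp (h2.comp h1)

variable {n : ℕ} {R : S n → Matrix (Fin n) (Fin n) ℝ}

theorem cube_eq (hR : IsRotationFamily n R) (ν : S n) {ρ : ℝ} (hρ : 0 < ρ) (x : E n) :
    cube R ν ρ x = {y | cubeNorm (R ν) (y - x) < ρ / 2} := by
  have h1 := (Matrix.mem_orthogonalGroup_iff (Fin n) ℝ).1 (hR.orthogonal ν)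
  have h2 := (Matrix.mem_orthogonalGroup_iff' (Fin n) ℝ).1 (hR.orthogonal ν)
  have key : ∀ a : Fin n → ℝ, (‖a‖ < ρ / 2 ↔ ∀ i, |a i| < ρ / 2) := fun a => by
    rw [pi_norm_lt_iff (by positivity)]; simp only [Real.norm_eq_abs]
  ext y
  simp only [cube, unitCube, Set.mem_image, Set.mem_ofPred_eq, cubeNorm, key]
  have h2' : (R ν).transpose * (R ν) = 1 := h2
  have h1' : (R ν) * (R ν).transpose = 1 := h1
  constructor
  · rintro ⟨a, ha, rfl⟩ i
    have : (R ν).transpose.mulVec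
        (WithLp.ofLp (x + ρ • Matrix.toEuclideanLin (R ν) a - x)) i = ρ * a i := by
      simp [Matrix.mulVec_mulVec, Matrix.mulVec_smul, h2', Matrix.toLpLin_apply]
    rw [this, abs_mul, abs_of_pos hρ]
    nlinarith [ha i]
  · intro h
    refine ⟨WithLp.toLp 2 (ρ⁻¹ • (R ν).transpose.mulVec (WithLp.ofLp (y - x))), fun i => ?_, ?_⟩
    · have := h i
      simp only [Pi.smul_apply, smul_eq_mul, abs_mul, abs_inv, abs_of_pos hρ]
      rw [inv_mul_lt_iff₀ hρ]; linarith
    · simp [Matrix.toLpLin_apply, smul_smul, hρ.ne', h1', Matrix.mulVec_mulVec]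

theorem cube_eq_preimage (hR : IsRotationFamily n R) (ν : S n) {ρ : ℝ} (hρ : 0 < ρ) (x : E n) :
    cube R ν ρ x = cubeChart (hR.orthogonal ν) x ⁻¹' Metric.ball 0 (ρ / 2) := by
  rw [cube_eq hR ν hρ]
  ext y
  simp [norm_cubeChart]

theorem isOpen_cube (hR : IsRotationFamily n R) (ν : S n) {ρ : ℝ} (hρ : 0 < ρ) (x : E n) :
    IsOpen (cube R ν ρ x) := by
  rw [cube_eq_preimage hR ν hρ]
  exact Metric.isOpen_ball.preimage (cubeChart _ x).continuous

theorem cube_subset_cube (hR : IsRotationFamily n R) (ν : S n) {r ρ : ℝ} (hr : 0 < r) (h : r ≤ ρ)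
    (x : E n) : cube R ν r x ⊆ cube R ν ρ x := by
  rw [cube_eq hR ν hr, cube_eq hR ν (hr.trans_le h)]
  intro y hy
  simp only [Set.mem_ofPred_eq] at hy ⊢
  linarith

theorem isCompact_cubeNorm_le (hR : IsRotationFamily n R) (ν : S n) (s : ℝ) (x : E n) :
    IsCompact {y | cubeNorm (R ν) (y - x) ≤ s} := by
  have : {y | cubeNorm (R ν) (y - x) ≤ s} =
      cubeChart (hR.orthogonal ν) x ⁻¹' Metric.closedBall 0 s := by
    ext y; simp [norm_cubeChart]
  rw [this]
  exact (cubeChart _ x).isCompact_preimage.2 (isCompact_closedBall _ _)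

theorem frontier_cube (hR : IsRotationFamily n R) (ν : S n) {ρ : ℝ} (hρ : 0 < ρ) (x : E n) :
    frontier (cube R ν ρ x) = {y | cubeNorm (R ν) (y - x) = ρ / 2} := by
  rw [cube_eq_preimage hR ν hρ, ← Homeomorph.preimage_frontier, frontier_ball _ (by positivity)]
  ext y; simp [norm_cubeChart]

theorem isBounded_cube (hR : IsRotationFamily n R) (ν : S n) {ρ : ℝ} (hρ : 0 < ρ) (x : E n) :
    Bornology.IsBounded (cube R ν ρ x) := by
  refine (isCompact_cubeNorm_le hR ν (ρ / 2) x).isBounded.subset ?_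
  rw [cube_eq hR ν hρ]
  intro y hy
  rw [Set.mem_ofPred_eq] at hy ⊢
  exact hy.le

theorem continuous_cubeNorm_sub (B : Matrix (Fin n) (Fin n) ℝ) (x : E n) :
    Continuous fun y => cubeNorm B (y - x) :=
  continuous_cubeNorm continuous_const (continuous_id.sub continuous_const)

theorem cubeChart_last (hn : 0 < n) (hR : IsRotationFamily n R) (ν : S n) (x y : E n) :
    cubeChart (hR.orthogonal ν) x y ⟨n - 1, by omega⟩ = inner ℝ (y - x) (ν : E n) := by
  have hν : ∀ j, (ν : E n) j = R ν j ⟨n - 1, by omega⟩ := by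
    intro j
    rw [← hR.map_lastVec ν]
    have : ∀ i : Fin n, ((i : ℕ) + 1 = n) ↔ i = ⟨n - 1, by omega⟩ := fun i => by
      rw [Fin.ext_iff]; simp only; omega
    simp [Matrix.toLpLin_apply, Matrix.mulVec, dotProduct, lastVec, this]
  change (R ν).transpose.mulVec (WithLp.ofLp (y - x)) _ = _
  simp [Matrix.mulVec, dotProduct, PiLp.inner_apply, hν]

/-- The distribution of the height `(y - x) ⬝ ν` over a cube centred at `x`. -/
theorem map_inner_restrict_cube (hn : 0 < n) (hR : IsRotationFamily n R) (ν : S n) {ρ : ℝ}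
    (hρ : 0 < ρ) (x : E n) :
    (volume.restrict (cube R ν ρ x)).map (fun y => inner ℝ (y - x) (ν : E n)) =
      ENNReal.ofReal (ρ ^ (n - 1)) • volume.restrict (Set.Ioo (-(ρ / 2)) (ρ / 2)) := by
  set i₀ : Fin n := ⟨n - 1, by omega⟩
  have e : (fun y => inner ℝ (y - x) (ν : E n)) =
      Function.eval i₀ ∘ cubeChart (hR.orthogonal ν) x := by
    ext y; exact (cubeChart_last hn hR ν x y).symm
  have hc := (cubeChart (hR.orthogonal ν) x).measurable
  rw [e, ← Measure.map_map (measurable_pi_apply i₀) hc, cube_eq_preimage hR ν hρ,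
    ← Measure.restrict_map hc Metric.isOpen_ball.measurableSet,
    (measurePreserving_cubeChart _ x).map_eq]
  have hb : Metric.ball (0 : Fin n → ℝ) (ρ / 2) =
      Set.univ.pi fun _ => Set.Ioo (-(ρ / 2)) (ρ / 2) := by
    rw [ball_pi _ (by positivity)]; simp [Real.ball_eq_Ioo]
  rw [hb, volume_pi, Measure.restrict_pi_pi, Measure.pi_map_eval]
  congr 1
  simp only [Measure.restrict_apply_univ, Real.volume_Ioo, Finset.prod_const]
  rw [Finset.card_erase_of_mem (Finset.mem_univ _), ENNReal.ofReal_pow hρ.le]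
  simp

theorem volume_cube (hR : IsRotationFamily n R) (ν : S n) {ρ : ℝ} (hρ : 0 < ρ) (x : E n) :
    volume (cube R ν ρ x) = ENNReal.ofReal (ρ ^ n) := by
  rw [cube_eq_preimage hR ν hρ, (measurePreserving_cubeChart _ x).measure_preimage
    Metric.isOpen_ball.measurableSet.nullMeasurableSet, Real.volume_pi_ball _ (by positivity)]
  simp; ring_nf

/-- A function equal to `1` on a cube and to `0` outside a larger cube with the same axes. -/
theorem exists_cube_cutoff (hR : IsRotationFamily n R) (ν : S n) {r s : ℝ} (hrs : r < s)
    (x : E n) : ∃ χ : E n → ℝ, ContDiff ℝ ∞ χ ∧ (∀ y, χ y ∈ Set.Icc (0 : ℝ) 1) ∧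
      (∀ y, cubeNorm (R ν) (y - x) ≤ r → χ y = 1) ∧
      (∀ y, s ≤ cubeNorm (R ν) (y - x) → χ y = 0) ∧
      tsupport χ ⊆ {y | cubeNorm (R ν) (y - x) ≤ s} ∧ HasCompactSupport χ := by
  have hc := continuous_cubeNorm_sub (R ν) x
  obtain ⟨χ, h0, h1, h01⟩ := exists_contMDiffMap_zero_one_of_isClosed (n := ⊤)
    (modelWithCornersSelf ℝ (E n))
    (s := {y | s ≤ cubeNorm (R ν) (y - x)}) (t := {y | cubeNorm (R ν) (y - x) ≤ r})
    (isClosed_le continuous_const hc) (isClosed_le hc continuous_const)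
    (Set.disjoint_left.2 fun y hy hy' => by
      simp only [Set.mem_ofPred_eq] at hy hy'; linarith)
  have hs : tsupport χ ⊆ {y | cubeNorm (R ν) (y - x) ≤ s} := by
    refine closure_minimal (fun y hy => ?_) (isClosed_le hc continuous_const)
    by_contra h
    rw [Set.mem_ofPred_eq, not_le] at h
    exact hy (h0 (by rw [Set.mem_ofPred_eq]; exact h.le))
  exact ⟨χ, χ.contMDiff.contDiff, h01, fun y hy => h1 hy, fun y hy => h0 hy, hs,
    (isCompact_cubeNorm_le hR ν s x).of_isClosed_subset (isClosed_tsupport _) hs⟩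

/-! ### Sobolev functions -/

theorem gradient_apply (v : E n → ℝ) (y : E n) (i : Fin n) :
    gradient v y i = fderiv ℝ v y (EuclideanSpace.single i 1) := by
  rw [← inner_gradient_left, EuclideanSpace.inner_single_right]
  simp only [conj_trivial, one_mul]

theorem continuous_gradient {v : E n → ℝ} (hv : ContDiff ℝ 1 v) : Continuous (gradient v) :=
  (InnerProductSpace.toDual ℝ (E n)).symm.continuous.comp (hv.continuous_fderiv one_ne_zero)

namespace HasSobolevGradient

variable {p : ℝ} {A B : Set (E n)} {u v : E n → ℝ} {g h : E n → E n}

theorem one_le_ofReal (hp : 1 ≤ p) : (1 : ℝ≥0∞) ≤ ENNReal.ofReal p := by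
  rw [← ENNReal.ofReal_one]; exact ENNReal.ofReal_le_ofReal hp

theorem mono (hu : HasSobolevGradient p A u g) (hBA : B ⊆ A) : HasSobolevGradient p B u g where
  memLp := hu.memLp.mono_measure (Measure.restrict_mono_set _ hBA)
  memLp_grad := hu.memLp_grad.mono_measure (Measure.restrict_mono_set _ hBA)
  weak φ hφ hc hs i := by
    have h1 : ∀ y, y ∉ tsupport φ → fderiv ℝ φ y (EuclideanSpace.single i 1) = 0 := fun y hy => by
      have : fderiv ℝ φ y = 0 := by
        by_contra h; exact hy (support_fderiv_subset ℝ h)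
      simp [this]
    have h0 : ∀ y, y ∉ tsupport φ → φ y = 0 := fun y hy => image_eq_zero_of_notMem_tsupport hy
    have := hu.weak φ hφ hc (hs.trans hBA) i
    have e : ∀ D : Set (E n), tsupport φ ⊆ D →
        ((∫ y in D, u y * fderiv ℝ φ y (EuclideanSpace.single i 1)) =
          ∫ y, u y * fderiv ℝ φ y (EuclideanSpace.single i 1)) ∧
        (∫ y in D, g y i * φ y) = ∫ y, g y i * φ y := fun D hD =>
      ⟨setIntegral_eq_integral_of_forall_compl_eq_zero fun y hy => by
        rw [h1 y fun h => hy (hD h), mul_zero],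
      setIntegral_eq_integral_of_forall_compl_eq_zero fun y hy => by
        rw [h0 y fun h => hy (hD h), mul_zero]⟩
    have h := hu.weak φ hφ hc (hs.trans hBA) i
    rwa [(e A (hs.trans hBA)).1, (e A (hs.trans hBA)).2, ← (e B hs).1, ← (e B hs).2] at h

theorem integrable_mul (hp : 1 ≤ p) {u : E n → ℝ} (hu : MemLp u (ENNReal.ofReal p)
    (volume.restrict A)) {ψ : E n → ℝ} (hψ : Continuous ψ) (hc : HasCompactSupport ψ) :
    Integrable (fun y => u y * ψ y) (volume.restrict A) := by
  have := (hu.locallyIntegrable (one_le_ofReal hp)).integrable_smul_left_of_hasCompactSupport hψ hc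
  simpa [mul_comm] using this

theorem memLp_apply (hu : HasSobolevGradient p A u g) (i : Fin n) :
    MemLp (fun y => g y i) (ENNReal.ofReal p) (volume.restrict A) :=
  (EuclideanSpace.proj (𝕜 := ℝ) i).comp_memLp' hu.memLp_grad

theorem continuous_partial {φ : E n → ℝ} (hφ : ContDiff ℝ ∞ φ) (i : Fin n) :
    Continuous fun y => fderiv ℝ φ y (EuclideanSpace.single i 1) :=
  (hφ.continuous_fderiv (by simp)).clm_apply continuous_const

theorem hasCompactSupport_partial {φ : E n → ℝ} (hc : HasCompactSupport φ) (i : Fin n) :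
    HasCompactSupport fun y => fderiv ℝ φ y (EuclideanSpace.single i 1) :=
  hc.fderiv_apply ℝ _

theorem add (hp : 1 ≤ p) (hu : HasSobolevGradient p A u g) (hv : HasSobolevGradient p A v h) :
    HasSobolevGradient p A (fun y => u y + v y) (fun y => g y + h y) where
  memLp := hu.memLp.add hv.memLp
  memLp_grad := hu.memLp_grad.add hv.memLp_grad
  weak φ hφ hc hs i := by
    have c1 := continuous_partial hφ i
    have c2 := hasCompactSupport_partial hc i
    simp only [PiLp.add_apply, add_mul]
    rw [integral_add (integrable_mul hp hu.memLp c1 c2) (integrable_mul hp hv.memLp c1 c2),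
      integral_add (integrable_mul hp (hu.memLp_apply i) hφ.continuous hc)
        (integrable_mul hp (hv.memLp_apply i) hφ.continuous hc),
      hu.weak φ hφ hc hs i, hv.weak φ hφ hc hs i]
    ring

theorem neg (hu : HasSobolevGradient p A u g) :
    HasSobolevGradient p A (fun y => - u y) (fun y => - g y) where
  memLp := hu.memLp.neg
  memLp_grad := hu.memLp_grad.neg
  weak φ hφ hc hs i := by
    simp only [PiLp.neg_apply, neg_mul, integral_neg, hu.weak φ hφ hc hs i]

theorem sub (hp : 1 ≤ p) (hu : HasSobolevGradient p A u g) (hv : HasSobolevGradient p A v h) :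
    HasSobolevGradient p A (fun y => u y - v y) (fun y => g y - h y) := by
  simpa only [sub_eq_add_neg] using hu.add hp hv.neg

theorem congr (hu : HasSobolevGradient p A u g) (huv : u =ᵐ[volume.restrict A] v)
    (hgh : g =ᵐ[volume.restrict A] h) : HasSobolevGradient p A v h where
  memLp := hu.memLp.ae_eq huv
  memLp_grad := hu.memLp_grad.ae_eq hgh
  weak φ hφ hc hs i := by
    have e1 : ∫ y in A, v y * fderiv ℝ φ y (EuclideanSpace.single i 1) =
        ∫ y in A, u y * fderiv ℝ φ y (EuclideanSpace.single i 1) :=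
      integral_congr_ae (by filter_upwards [huv] with y hy; rw [hy])
    have e2 : ∫ y in A, h y i * φ y = ∫ y in A, g y i * φ y :=
      integral_congr_ae (by filter_upwards [hgh] with y hy; rw [hy])
    rw [e1, e2, hu.weak φ hφ hc hs i]

theorem memLp_of_continuous {F : Type*} [NormedAddCommGroup F]
    [SecondCountableTopologyEither (E n) F] (hA : IsOpen A) (hb : Bornology.IsBounded A)
    {k : E n → F} (hk : Continuous k) : MemLp k (ENNReal.ofReal p) (volume.restrict A) := by
  obtain ⟨C, hC⟩ := (hb.isCompact_closure.image hk).isBounded.exists_norm_le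
  have : IsFiniteMeasure (volume.restrict A) := ⟨by
    rw [Measure.restrict_apply_univ]; exact hb.measure_lt_top⟩
  refine MemLp.of_bound hk.aestronglyMeasurable C ?_
  refine (ae_restrict_iff' hA.measurableSet).2 (Eventually.of_forall fun y hy => ?_)
  exact hC _ ⟨y, subset_closure hy, rfl⟩

/-- A `C¹` function on a bounded open set is a Sobolev function, and its weak gradient is the
classical one. -/
theorem of_contDiff (hA : IsOpen A) (hb : Bornology.IsBounded A) (hv : ContDiff ℝ 1 v) :
    HasSobolevGradient p A v (gradient v) where
  memLp := memLp_of_continuous hA hb hv.continuous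
  memLp_grad := memLp_of_continuous hA hb (continuous_gradient hv)
  weak φ hφ hc hs i := by
    have hs' : ∀ y, y ∉ A → φ y = 0 := fun y hy =>
      image_eq_zero_of_notMem_tsupport fun h => hy (hs h)
    have hd : ∀ y, y ∉ A → fderiv ℝ φ y (EuclideanSpace.single i 1) = 0 := fun y hy => by
      have : fderiv ℝ φ y = 0 := by
        by_contra h; exact hy (hs (support_fderiv_subset ℝ h))
      simp [this]
    have hdv : Continuous fun y => fderiv ℝ v y (EuclideanSpace.single i 1) :=
      (hv.continuous_fderiv one_ne_zero).clm_apply continuous_const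
    rw [setIntegral_eq_integral_of_forall_compl_eq_zero fun y hy => by rw [hd y hy, mul_zero],
      setIntegral_eq_integral_of_forall_compl_eq_zero fun y hy => by rw [hs' y hy, mul_zero]]
    simp only [gradient_apply]
    apply integral_mul_fderiv_eq_neg_fderiv_mul_of_integrable
    · exact (hdv.mul hφ.continuous).integrable_of_hasCompactSupport hc.mul_left
    · exact (hv.continuous.mul (continuous_partial hφ i)).integrable_of_hasCompactSupport
        (hasCompactSupport_partial hc i).mul_left
    · exact (hv.continuous.mul hφ.continuous).integrable_of_hasCompactSupport hc.mul_left
    · exact fun y _ => (hv.differentiable one_ne_zero) y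
    · exact fun y _ => (hφ.differentiable (by simp)) y

/-- If `u` and its gradient vanish outside an open subset `K` of `A` that stays away from the
boundary of `A`, in the sense that it admits a cutoff function `χ` supported in `A`, then the
extension of `u` by zero is a Sobolev function on the whole space. -/
theorem extend_zero {K : Set (E n)} {χ : E n → ℝ}
    (hu : HasSobolevGradient p A u g) (hK : IsOpen K) (hKA : K ⊆ A)
    (hχ : ContDiff ℝ ∞ χ) (hχA : tsupport χ ⊆ A)
    (hχK : ∀ y ∈ K, χ y = 1) (h0 : ∀ᵐ y ∂(volume.restrict A), y ∉ K → u y = 0)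
    (h1 : ∀ᵐ y ∂(volume.restrict A), y ∉ K → g y = 0) :
    HasSobolevGradient p Set.univ (K.indicator u) (K.indicator g) where
  memLp := by
    rw [Measure.restrict_univ, memLp_indicator_iff_restrict hK.measurableSet]
    exact (hu.mono hKA).memLp
  memLp_grad := by
    rw [Measure.restrict_univ, memLp_indicator_iff_restrict hK.measurableSet]
    exact (hu.mono hKA).memLp_grad
  weak φ hφ hc _ i := by
    have hw := hu.weak (fun y => χ y * φ y) (hχ.mul hφ) (hc.mul_left)
      (tsupport_mul_subset_left.trans hχA) i
    have hfd : ∀ y ∈ K, fderiv ℝ (fun y => χ y * φ y) y = fderiv ℝ φ y := fun y hy => by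
      apply Filter.EventuallyEq.fderiv_eq
      filter_upwards [hK.mem_nhds hy] with z hz
      rw [hχK z hz, one_mul]
    have e : ∀ (a ψ ψ' : E n → ℝ), (∀ᵐ y ∂(volume.restrict A), y ∉ K → a y = 0) →
        (∀ y ∈ K, ψ' y = ψ y) →
        ∫ y, K.indicator a y * ψ y = ∫ y in A, a y * ψ' y := by
      intro a ψ ψ' ha hψ
      have : ∫ y in A, a y * ψ' y = ∫ y in A, K.indicator a y * ψ y := by
        refine integral_congr_ae ?_
        filter_upwards [ha] with y hy
        by_cases hyK : y ∈ K
        · simp [hyK, hψ y hyK]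
        · simp [hyK, hy hyK]
      rw [this, setIntegral_eq_integral_of_forall_compl_eq_zero]
      intro y hy
      have : y ∉ K := fun h => hy (hKA h)
      simp [this]
    simp only [Measure.restrict_univ]
    rw [e u _ (fun y => fderiv ℝ (fun y => χ y * φ y) y (EuclideanSpace.single i 1)) h0
      (fun y hy => by rw [hfd y hy]), hw]
    have : ∀ y, K.indicator g y i = K.indicator (fun y => g y i) y := fun y => by
      by_cases hy : y ∈ K <;> simp [hy]
    simp only [this]
    rw [e (fun y => g y i) φ (fun y => χ y * φ y) (by
      filter_upwards [h1] with y hy hyK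
      simp [hy hyK]) (fun y hy => by rw [hχK y hy, one_mul])]

end HasSobolevGradient

/-- A competitor on a cube differs from its boundary datum by a Sobolev function on the whole
space that vanishes outside a strictly smaller cube. -/
theorem exists_decomposition_of_mem_admissible (hR : IsRotationFamily n R) (ν : S n) {ρ p : ℝ}
    (hp : 1 ≤ p) (hρ : 0 < ρ) (x : E n) {u v : E n → ℝ} (hv : ContDiff ℝ 1 v)
    (hu : u ∈ admissible p v (cube R ν ρ x)) :
    ∃ (r : ℝ) (z : E n → ℝ) (h : E n → E n), 0 < r ∧ r < ρ ∧ HasSobolevGradient p Set.univ z h ∧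
      (∀ y ∉ cube R ν r x, z y = 0) ∧ (∀ y ∉ cube R ν r x, h y = 0) ∧
      (∀ᵐ y ∂(volume.restrict (cube R ν ρ x)), u y = v y + z y) ∧
      HasSobolevGradient p (cube R ν ρ x) u (fun y => gradient v y + h y) := by
  obtain ⟨⟨⟨g, hg⟩, -⟩, U, hU, hfU, huv⟩ := hu
  set A := cube R ν ρ x with hAdef
  have hA : IsOpen A := isOpen_cube hR ν hρ x
  have hN := continuous_cubeNorm_sub (R ν) x
  -- The complement of `U` in the closed cube is compact, so it lies in a strictly smaller cube.
  obtain ⟨r₀, hr₀, hr₀'⟩ : ∃ r₀ < ρ / 2, ∀ y, cubeNorm (R ν) (y - x) ≤ ρ / 2 → y ∉ U →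
      cubeNorm (R ν) (y - x) ≤ r₀ := by
    have hC : IsCompact ({y | cubeNorm (R ν) (y - x) ≤ ρ / 2} \ U) :=
      (isCompact_cubeNorm_le hR ν (ρ / 2) x).diff hU
    rcases ({y | cubeNorm (R ν) (y - x) ≤ ρ / 2} \ U).eq_empty_or_nonempty with he | hne
    · refine ⟨0, by positivity, fun y hy hyU => absurd ?_ (Set.notMem_empty y)⟩
      rw [← he]; exact ⟨hy, hyU⟩
    · obtain ⟨y₀, ⟨hy₀, hy₀U⟩, hmax⟩ := hC.exists_isMaxOn hne hN.continuousOn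
      refine ⟨cubeNorm (R ν) (y₀ - x), lt_of_le_of_ne hy₀ fun h => hy₀U (hfU ?_), fun y hy hyU =>
        hmax ⟨hy, hyU⟩⟩
      rw [frontier_cube hR ν hρ]
      exact h
  obtain ⟨r₁, hr₁, hr₁'⟩ := exists_between (max_lt hr₀ (half_pos hρ))
  have hr₁0 : 0 < r₁ := (le_max_right _ _).trans_lt hr₁
  have hr₁1 : r₀ < r₁ := (le_max_left _ _).trans_lt hr₁
  obtain ⟨s, hs, hs'⟩ := exists_between hr₁'
  have hK : cube R ν (2 * r₁) x = {y | cubeNorm (R ν) (y - x) < r₁} := by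
    rw [cube_eq hR ν (by positivity)]; congr 1; ext y; rw [mul_div_cancel_left₀ _ two_ne_zero]
  have hAeq : A = {y | cubeNorm (R ν) (y - x) < ρ / 2} := cube_eq hR ν hρ x
  have hKo : IsOpen (cube R ν (2 * r₁) x) := isOpen_cube hR ν (by positivity) x
  have hKA : cube R ν (2 * r₁) x ⊆ A := cube_subset_cube hR ν (by positivity) (by linarith) x
  have hb : Bornology.IsBounded A := isBounded_cube hR ν hρ x
  obtain ⟨χ, hχ, -, hχ1, -, hχs, -⟩ := exists_cube_cutoff hR ν hs x
  have hvA : HasSobolevGradient p A v (gradient v) := .of_contDiff hA hb hv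
  have hd := hg.sub hp hvA
  have hUA : ∀ y ∈ A, r₀ < cubeNorm (R ν) (y - x) → y ∈ U := fun y hy h => by
    by_contra hyU
    rw [hAeq] at hy
    exact absurd (hr₀' y (le_of_lt hy) hyU) (not_le.2 h)
  set O := A ∩ U
  have hO : IsOpen O := hA.inter hU
  have huvO : u =ᵐ[volume.restrict O] v := by
    have : O = U ∩ A := Set.inter_comm _ _
    rw [this]; exact huv
  have hgO : g =ᵐ[volume.restrict O] gradient v :=
    HasSobolevGradient.ae_unique hp hO (hg.mono Set.inter_subset_left)
      ((hvA.mono Set.inter_subset_left).congr huvO.symm (ae_eq_refl _))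
  have hout : ∀ {P : E n → Prop}, (∀ᵐ y ∂(volume.restrict O), P y) →
      ∀ᵐ y ∂(volume.restrict A), y ∉ cube R ν (2 * r₁) x → P y := by
    intro P hP
    rw [ae_restrict_iff' hO.measurableSet] at hP
    rw [ae_restrict_iff' hA.measurableSet]
    filter_upwards [hP] with y hy hyA hyK
    rw [hK, Set.mem_ofPred_eq, not_lt] at hyK
    exact hy ⟨hyA, hUA y hyA (by linarith)⟩
  have h0 := hout huvO
  have h1 := hout hgO
  have hext := hd.extend_zero (K := cube R ν (2 * r₁) x) hKo hKA hχ
    (fun y hy => by rw [hAeq]; exact lt_of_le_of_lt (hχs hy) hs')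
    (fun y hy => hχ1 y (by rw [hK] at hy; exact le_of_lt hy))
    (by filter_upwards [h0] with y hy hyK; rw [hy hyK, sub_self])
    (by filter_upwards [h1] with y hy hyK; rw [hy hyK, sub_self])
  refine ⟨2 * r₁, _, _, by positivity, by linarith, hext, fun y hy => by simp [hy],
    fun y hy => by simp [hy], ?_, hg.congr (ae_eq_refl _) ?_⟩
  · filter_upwards [h0] with y hy
    by_cases hyK : y ∈ cube R ν (2 * r₁) x
    · simp [hyK]
    · simp [hyK, hy hyK]
  · filter_upwards [h1] with y hy
    by_cases hyK : y ∈ cube R ν (2 * r₁) x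
    · simp [hyK]
    · simp [hyK, hy hyK]

/-! ### Transition profiles and boundary data -/

/-- A profile as in `IsProfile`, with the transition taking place in `[-T, T]`. -/
structure IsTransition (T : ℝ) (w : ℝ → ℝ) : Prop where
  contDiff : ContDiff ℝ 1 w
  mem_Icc : ∀ t, w t ∈ Set.Icc (0 : ℝ) 1
  eq_zero : ∀ t, t < -T → w t = 0
  eq_one : ∀ t, T < t → w t = 1

theorem IsProfile.isTransition {w : ℝ → ℝ} (hw : IsProfile w) : IsTransition 1 w :=
  ⟨hw.contDiff, hw.mem_Icc, hw.eq_zero, hw.eq_one⟩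

namespace IsTransition

variable {T T' : ℝ} {w : ℝ → ℝ}

theorem mono (hw : IsTransition T w) (h : T ≤ T') : IsTransition T' w :=
  ⟨hw.contDiff, hw.mem_Icc, fun t ht => hw.eq_zero t (by linarith),
    fun t ht => hw.eq_one t (by linarith)⟩

theorem deriv_eq_zero (hw : IsTransition T w) {t : ℝ} (ht : T < |t|) : deriv w t = 0 := by
  rcases lt_abs.1 ht with h | h
  · have : w =ᶠ[𝓝 t] fun _ => 1 := by
      filter_upwards [lt_mem_nhds h] with s hs using hw.eq_one s hs
    rw [this.deriv_eq]; simp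
  · have : w =ᶠ[𝓝 t] fun _ => 0 := by
      filter_upwards [gt_mem_nhds (show t < -T by linarith)] with s hs using hw.eq_zero s hs
    rw [this.deriv_eq]; simp

theorem exists_bound_deriv (hw : IsTransition T w) : ∃ L, 0 ≤ L ∧ ∀ t, |deriv w t| ≤ L := by
  have hc : Continuous (deriv w) := hw.contDiff.continuous_deriv le_rfl
  obtain ⟨C, hC⟩ := ((isCompact_Icc (a := -T) (b := T)).image hc).isBounded.exists_norm_le
  refine ⟨max C 0, le_max_right _ _, fun t => ?_⟩
  by_cases ht : T < |t|
  · rw [hw.deriv_eq_zero ht]; simp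
  · exact (hC _ ⟨t, abs_le.1 (not_lt.1 ht), rfl⟩).trans (le_max_left _ _)

end IsTransition

theorem contDiff_boundaryDatum {w : ℝ → ℝ} (hw : ContDiff ℝ 1 w) (ε : ℝ) (x : E n) (ν : S n) :
    ContDiff ℝ 1 (boundaryDatum w ε x ν) := by
  unfold boundaryDatum
  exact hw.comp (contDiff_const.mul ((contDiff_id.sub contDiff_const).inner ℝ contDiff_const))

theorem hasGradientAt_boundaryDatum {w : ℝ → ℝ} (hw : ContDiff ℝ 1 w) (ε : ℝ) (x : E n) (ν : S n)
    (y : E n) : HasGradientAt (boundaryDatum w ε x ν)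
      ((1 / ε * deriv w (1 / ε * inner ℝ (y - x) (ν : E n))) • (ν : E n)) y := by
  have h1 : HasFDerivAt (fun y : E n => inner ℝ (y - x) (ν : E n)) (innerSL ℝ (ν : E n)) y := by
    have : (fun y : E n => inner ℝ (y - x) (ν : E n)) =
        fun y => innerSL ℝ (ν : E n) y - inner ℝ x (ν : E n) := by
      ext y; rw [inner_sub_left]; simp [real_inner_comm]
    rw [this]
    exact (innerSL ℝ (ν : E n)).hasFDerivAt.sub_const _
  have h2 := ((hw.differentiable one_ne_zero) (1 / ε * inner ℝ (y - x) (ν : E n))).hasDerivAt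
  have h3 := h2.comp_hasFDerivAt y (h1.const_mul (1 / ε))
  have e : InnerProductSpace.toDual ℝ (E n)
      ((1 / ε * deriv w (1 / ε * inner ℝ (y - x) (ν : E n))) • (ν : E n)) =
      deriv w (1 / ε * inner ℝ (y - x) (ν : E n)) • (1 / ε) • innerSL ℝ (ν : E n) := by
    ext z
    simp only [InnerProductSpace.toDual_apply_apply, real_inner_smul_left, smul_apply,
      innerSL_apply_apply, smul_eq_mul]
    ring
  rw [hasGradientAt_iff_hasFDerivAt, e]
  exact h3

theorem norm_gradient (v : E n → ℝ) (y : E n) : ‖gradient v y‖ = ‖fderiv ℝ v y‖ :=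
  LinearIsometryEquiv.norm_map _ _

theorem norm_fderiv_boundaryDatum {w : ℝ → ℝ} (hw : ContDiff ℝ 1 w) {ε : ℝ} (hε : 0 < ε) (x : E n)
    (ν : S n) (y : E n) : ε * ‖fderiv ℝ (boundaryDatum w ε x ν) y‖ =
      |deriv w (1 / ε * inner ℝ (y - x) (ν : E n))| := by
  have hν : ‖(ν : E n)‖ = 1 := by simp
  rw [← norm_gradient, (hasGradientAt_boundaryDatum hw ε x ν y).gradient, norm_smul, hν, mul_one,
    norm_mul, Real.norm_eq_abs, Real.norm_eq_abs, abs_of_pos (by positivity : 0 < 1 / ε)]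
  field_simp

/-! ### Comparison of minimal energies -/

/-- The interpolation `χ v + (1 - χ) v'`. -/
def interpolate (χ v v' : E n → ℝ) (y : E n) : ℝ := χ y * v y + (1 - χ y) * v' y

section interpolate

variable {χ v v' : E n → ℝ}

theorem contDiff_interpolate (hχ : ContDiff ℝ ∞ χ) (hv : ContDiff ℝ 1 v) (hv' : ContDiff ℝ 1 v') :
    ContDiff ℝ 1 (interpolate χ v v') := by
  have : ContDiff ℝ 1 χ := hχ.of_le (by exact_mod_cast le_top)
  unfold interpolate
  fun_prop

theorem interpolate_mem_Icc {y : E n} (hχ : χ y ∈ Set.Icc (0 : ℝ) 1)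
    (hv : v y ∈ Set.Icc (0 : ℝ) 1) (hv' : v' y ∈ Set.Icc (0 : ℝ) 1) :
    interpolate χ v v' y ∈ Set.Icc (0 : ℝ) 1 := by
  obtain ⟨a1, a2⟩ := hχ
  obtain ⟨b1, b2⟩ := hv
  obtain ⟨d1, d2⟩ := hv'
  unfold interpolate
  constructor
  · have := mul_nonneg a1 b1
    have := mul_nonneg (sub_nonneg.2 a2) d1
    linarith
  · nlinarith

theorem fderiv_interpolate (hχ : ContDiff ℝ ∞ χ) (hv : ContDiff ℝ 1 v) (hv' : ContDiff ℝ 1 v')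
    (y : E n) : fderiv ℝ (interpolate χ v v') y =
      χ y • fderiv ℝ v y + (1 - χ y) • fderiv ℝ v' y + (v y - v' y) • fderiv ℝ χ y := by
  have h1 := (hχ.differentiable (by simp) y).hasFDerivAt
  have h2 := (hv.differentiable one_ne_zero y).hasFDerivAt
  have h3 := (hv'.differentiable one_ne_zero y).hasFDerivAt
  have := (h1.mul h2).add ((h1.const_sub 1).mul h3)
  have e : interpolate χ v v' = (χ * v + (fun y => 1 - χ y) * v') := by
    ext y; simp [interpolate]
  rw [e, this.fderiv]
  ext z
  simp
  ring

end interpolate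

/-- A Sobolev function that equals the datum outside a strictly smaller cube is a competitor. -/
theorem mem_admissible_of_eq (hR : IsRotationFamily n R) (ν : S n) {ρ p s : ℝ} (hρ : 0 < ρ)
    (x : E n) {u v : E n → ℝ} (hu : u ∈ sobolevUnit p (cube R ν ρ x)) (hs : s < ρ / 2)
    (h : ∀ y, s < cubeNorm (R ν) (y - x) → u y = v y) : u ∈ admissible p v (cube R ν ρ x) := by
  have hN := continuous_cubeNorm_sub (R ν) x
  refine ⟨hu, {y | s < cubeNorm (R ν) (y - x)}, isOpen_lt continuous_const hN, ?_, ?_⟩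
  · rw [frontier_cube hR ν hρ]
    intro y hy
    rw [Set.mem_ofPred_eq] at hy ⊢
    linarith
  · have ho : IsOpen ({y | s < cubeNorm (R ν) (y - x)} ∩ cube R ν ρ x) :=
      (isOpen_lt continuous_const hN).inter (isOpen_cube hR ν hρ x)
    exact (ae_restrict_iff' ho.measurableSet).2 (Eventually.of_forall fun y hy => h y hy.1)

variable {W : ℝ → ℝ} {p c₁ c₂ : ℝ}

/-- Let `v + z` be a competitor for some datum `v`, with `z` supported in the open set `K`. Gluing
it to another datum `v'` outside `K` by means of a cutoff function `χ` costs at most the energy of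
the interpolation of the two data there. -/
theorem minEnergy_le_of_interpolate (hR : IsRotationFamily n R) (ν : S n) {ρ s : ℝ} (hρ : 0 < ρ)
    (x : E n) {f : E n → ℝ → E n → ℝ} (hp : 1 ≤ p) (hf : IsIntegrand W p c₁ c₂ f) (ε : ℝ)
    {χ v v' z : E n → ℝ} {h : E n → E n} {K : Set (E n)}
    (hv : ContDiff ℝ 1 v) (hv01 : ∀ y, v y ∈ Set.Icc (0 : ℝ) 1)
    (hv' : ContDiff ℝ 1 v') (hv'01 : ∀ y, v' y ∈ Set.Icc (0 : ℝ) 1)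
    (hχ : ContDiff ℝ ∞ χ) (hχ01 : ∀ y, χ y ∈ Set.Icc (0 : ℝ) 1) (hs : s < ρ / 2)
    (hK : IsOpen K) (hKs : ∀ y ∈ K, cubeNorm (R ν) (y - x) ≤ s)
    (hχK : ∀ y ∈ K, χ y = 1) (hχs : ∀ y, s ≤ cubeNorm (R ν) (y - x) → χ y = 0)
    (hz : HasSobolevGradient p Set.univ z h) (hzK : ∀ y ∉ K, z y = 0) (hhK : ∀ y ∉ K, h y = 0)
    (h01 : ∀ᵐ y ∂(volume.restrict K), v y + z y ∈ Set.Icc (0 : ℝ) 1) :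
    minEnergy f ε p v' (cube R ν ρ x) ≤ ENNReal.ofReal (1 / ε) *
      ((∫⁻ y in K, ENNReal.ofReal (f y (v y + z y) (ε • (gradient v y + h y)))) +
        ∫⁻ y in cube R ν ρ x \ K, ENNReal.ofReal
          (c₂ * (W (interpolate χ v v' y) + ‖ε • gradient (interpolate χ v v') y‖ ^ p))) := by
  set A := cube R ν ρ x
  have hA : IsOpen A := isOpen_cube hR ν hρ x
  have hb : Bornology.IsBounded A := isBounded_cube hR ν hρ x
  have hAeq : A = {y | cubeNorm (R ν) (y - x) < ρ / 2} := cube_eq hR ν hρ x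
  have hKA : K ⊆ A := fun y hy => by
    rw [hAeq]; exact lt_of_le_of_lt (hKs y hy) hs
  set V := interpolate χ v v'
  have hV : ContDiff ℝ 1 V := contDiff_interpolate hχ hv hv'
  have hsob : HasSobolevGradient p A (fun y => V y + z y) (fun y => gradient V y + h y) :=
    (HasSobolevGradient.of_contDiff hA hb hV).add hp (hz.mono (Set.subset_univ A))
  have hVK : ∀ y ∈ K, V y = v y := fun y hy => by simp [V, interpolate, hχK y hy]
  have hgK : ∀ y ∈ K, gradient V y = gradient v y := fun y hy => by
    apply Filter.EventuallyEq.gradient_eq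
    filter_upwards [hK.mem_nhds hy] with a ha using hVK a ha
  have hu01 : ∀ᵐ y ∂(volume.restrict A), V y + z y ∈ Set.Icc (0 : ℝ) 1 := by
    rw [ae_restrict_iff' hK.measurableSet] at h01
    rw [ae_restrict_iff' hA.measurableSet]
    filter_upwards [h01] with y hy _
    by_cases hyK : y ∈ K
    · rw [hVK y hyK]; exact hy hyK
    · rw [hzK y hyK, add_zero]; exact interpolate_mem_Icc (hχ01 y) (hv01 y) (hv'01 y)
  have hadm : (fun y => V y + z y) ∈ admissible p v' A := by
    refine mem_admissible_of_eq hR ν hρ x ⟨⟨_, hsob⟩, hu01⟩ hs fun y hy => ?_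
    have : y ∉ K := fun hyK => absurd (hKs y hyK) (not_le.2 hy)
    simp [V, interpolate, hzK y this, hχs y hy.le]
  refine (iInf₂_le _ hadm).trans ?_
  rw [energy_eq f ε hp hA hsob hu01]
  gcongr
  rw [← lintegral_inter_add_sdiff _ A hK.measurableSet, Set.inter_eq_right.2 hKA]
  gcongr ?_ + ?_
  · refine (setLIntegral_congr_fun hK.measurableSet fun y hy => ?_).le
    simp only [hVK y hy, hgK y hy]
  · refine setLIntegral_mono' (hA.measurableSet.diff hK.measurableSet) fun y hy => ?_
    rw [hzK y hy.2, hhK y hy.2, add_zero, add_zero]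
    exact ENNReal.ofReal_le_ofReal (hf.upper _ _ _)

/-- A bound on the energy density of the interpolation of two data, independent of the cutoff
function as long as the data are close to each other where its gradient is large. -/
theorem layer_density_le {χ v v' : E n → ℝ} (hχ : ContDiff ℝ ∞ χ)
    (hv : ContDiff ℝ 1 v) (hv' : ContDiff ℝ 1 v') {ε L M : ℝ} (hε : 0 < ε) (hp : 0 ≤ p)
    (hc₂ : 0 ≤ c₂) (hM : ∀ t ∈ Set.Icc (0 : ℝ) 1, W t ≤ M) {y : E n}
    (hχ01 : χ y ∈ Set.Icc (0 : ℝ) 1) (hv01 : v y ∈ Set.Icc (0 : ℝ) 1)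
    (hv'01 : v' y ∈ Set.Icc (0 : ℝ) 1) (hL : ε * ‖fderiv ℝ v y‖ ≤ L)
    (hL' : ε * ‖fderiv ℝ v' y‖ ≤ L) (hsmall : ε * (|v y - v' y| * ‖fderiv ℝ χ y‖) ≤ 1) :
    c₂ * (W (interpolate χ v v' y) + ‖ε • gradient (interpolate χ v v') y‖ ^ p) ≤
      c₂ * (M + (2 * L + 1) ^ p) := by
  have hb : ‖ε • gradient (interpolate χ v v') y‖ ≤ 2 * L + 1 := by
    rw [norm_smul, norm_gradient, fderiv_interpolate hχ hv hv', Real.norm_eq_abs, abs_of_pos hε]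
    have h1 : ‖χ y • fderiv ℝ v y + (1 - χ y) • fderiv ℝ v' y + (v y - v' y) • fderiv ℝ χ y‖ ≤
        ‖fderiv ℝ v y‖ + ‖fderiv ℝ v' y‖ + |v y - v' y| * ‖fderiv ℝ χ y‖ := by
      refine (norm_add₃_le).trans ?_
      rw [norm_smul, norm_smul, norm_smul, Real.norm_eq_abs, Real.norm_eq_abs, Real.norm_eq_abs,
        abs_of_nonneg hχ01.1, abs_of_nonneg (sub_nonneg.2 hχ01.2)]
      have := mul_le_of_le_one_left (norm_nonneg (fderiv ℝ v y)) hχ01.2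
      have := mul_le_of_le_one_left (norm_nonneg (fderiv ℝ v' y))
        (show 1 - χ y ≤ 1 by linarith [hχ01.1])
      linarith
    nlinarith
  gcongr
  exact hM _ (interpolate_mem_Icc hχ01 hv01 hv'01)

theorem volume_cube_inter_slab (hn : 0 < n) (hR : IsRotationFamily n R) (ν : S n) {ρ τ : ℝ}
    (hρ : 0 < ρ) (x : E n) (hτ : τ < ρ / 2) :
    volume ({y | |inner ℝ (y - x) (ν : E n)| ≤ τ} ∩ cube R ν ρ x) =
      ENNReal.ofReal (ρ ^ (n - 1)) * ENNReal.ofReal (2 * τ) := by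
  have hm : Measurable fun y : E n => (inner ℝ (y - x) (ν : E n) : ℝ) := by fun_prop
  have e : {y | |inner ℝ (y - x) (ν : E n)| ≤ τ} =
      (fun y : E n => (inner ℝ (y - x) (ν : E n) : ℝ)) ⁻¹' Set.Icc (-τ) τ := by
    ext y; simp [abs_le]
  rw [e, ← Measure.restrict_apply (hm measurableSet_Icc), ← Measure.map_apply hm measurableSet_Icc,
    map_inner_restrict_cube hn hR ν hρ x, Measure.smul_apply, Measure.restrict_apply
    measurableSet_Icc, Set.inter_eq_left.2, Real.volume_Icc, smul_eq_mul]
  · ring_nf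
  · intro t ht
    exact ⟨by linarith [ht.1], by linarith [ht.2]⟩

/-- The energy of the interpolation of two one-dimensional transitions in the region between two
concentric cubes is controlled by the area of the part of the interface in that region. -/
theorem layer_energy_le (hn : 0 < n) (hR : IsRotationFamily n R) (ν : S n) {r ρ : ℝ} (hr : 0 < r)
    (hrρ : r ≤ ρ) (x : E n) (hW : IsDoubleWell W) (hp : 0 < p) (hc₂ : 0 ≤ c₂) {ε L M T : ℝ}
    (hε : 0 < ε) (hM : ∀ t ∈ Set.Icc (0 : ℝ) 1, W t ≤ M) {χ : E n → ℝ} (hχ : ContDiff ℝ ∞ χ)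
    (hχ01 : ∀ y, χ y ∈ Set.Icc (0 : ℝ) 1) {w w' : ℝ → ℝ} (hT : 0 < T) (hw : IsTransition T w)
    (hw' : IsTransition T w') (hL : ∀ t, |deriv w t| ≤ L) (hL' : ∀ t, |deriv w' t| ≤ L)
    (hsmall : ∀ y, ε * (|boundaryDatum w ε x ν y - boundaryDatum w' ε x ν y| *
      ‖fderiv ℝ χ y‖) ≤ 1) (hTε : T * ε < r / 2) :
    ENNReal.ofReal (1 / ε) * ∫⁻ y in cube R ν ρ x \ cube R ν r x, ENNReal.ofReal
        (c₂ * (W (interpolate χ (boundaryDatum w ε x ν) (boundaryDatum w' ε x ν) y) +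
          ‖ε • gradient (interpolate χ (boundaryDatum w ε x ν) (boundaryDatum w' ε x ν)) y‖ ^ p)) ≤
      ENNReal.ofReal (2 * T * (c₂ * (M + (2 * L + 1) ^ p)) * (ρ ^ (n - 1) - r ^ (n - 1))) := by
  set C := c₂ * (M + (2 * L + 1) ^ p)
  have hL0 : 0 ≤ L := (abs_nonneg _).trans (hL 0)
  have hM0 : 0 ≤ M := (hW.nonneg 0).trans (hM 0 ⟨le_rfl, zero_le_one⟩)
  have hC : 0 ≤ C := by positivity
  have hρ := hr.trans_le hrρ
  set v := boundaryDatum w ε x ν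
  set v' := boundaryDatum w' ε x ν
  have hv : ContDiff ℝ 1 v := contDiff_boundaryDatum hw.contDiff ε x ν
  have hv' : ContDiff ℝ 1 v' := contDiff_boundaryDatum hw'.contDiff ε x ν
  set Sl : Set (E n) := {y | |inner ℝ (y - x) (ν : E n)| ≤ T * ε}
  have hSl : MeasurableSet Sl := by
    have : Continuous fun y : E n => |(inner ℝ (y - x) (ν : E n) : ℝ)| := by fun_prop
    exact (isClosed_le this continuous_const).measurableSet
  set A := cube R ν ρ x
  set K := cube R ν r x
  have hKA : K ⊆ A := cube_subset_cube hR ν hr hrρ x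
  have hKm : MeasurableSet K := (isOpen_cube hR ν hr x).measurableSet
  have hAm : MeasurableSet A := (isOpen_cube hR ν hρ x).measurableSet
  have hpt : ∀ y, ENNReal.ofReal (c₂ * (W (interpolate χ v v' y) +
      ‖ε • gradient (interpolate χ v v') y‖ ^ p)) ≤ Sl.indicator (fun _ => ENNReal.ofReal C) y := by
    intro y
    by_cases hy : y ∈ Sl
    · rw [Set.indicator_of_mem hy]
      refine ENNReal.ofReal_le_ofReal (layer_density_le hχ hv hv' hε hp.le hc₂ hM (hχ01 y)
        (hw.mem_Icc _) (hw'.mem_Icc _) ?_ ?_ (hsmall y))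
      · rw [norm_fderiv_boundaryDatum hw.contDiff hε]; exact hL _
      · rw [norm_fderiv_boundaryDatum hw'.contDiff hε]; exact hL' _
    · -- Outside the slab both data are constant, equal to the same well.
      rw [Set.indicator_of_notMem hy]
      rw [Set.mem_ofPred_eq, not_le] at hy
      set t := (inner ℝ (y - x) (ν : E n) : ℝ)
      have ht : T < |1 / ε * t| := by
        rw [abs_mul, abs_of_pos (by positivity : 0 < 1 / ε), one_div, lt_inv_mul_iff₀ hε]
        linarith
      have hd : fderiv ℝ v y = 0 := by
        have := norm_fderiv_boundaryDatum hw.contDiff hε x ν y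
        rw [hw.deriv_eq_zero ht, abs_zero] at this
        exact norm_eq_zero.1 ((mul_eq_zero.1 this).resolve_left hε.ne')
      have hd' : fderiv ℝ v' y = 0 := by
        have := norm_fderiv_boundaryDatum hw'.contDiff hε x ν y
        rw [hw'.deriv_eq_zero ht, abs_zero] at this
        exact norm_eq_zero.1 ((mul_eq_zero.1 this).resolve_left hε.ne')
      have hvv : v y = v' y ∧ (v y = 0 ∨ v y = 1) := by
        rcases lt_abs.1 ht with h | h
        · have h1 : v y = 1 := hw.eq_one _ h
          have h2 : v' y = 1 := hw'.eq_one _ h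
          exact ⟨h1.trans h2.symm, Or.inr h1⟩
        · have h1 : v y = 0 := hw.eq_zero _ (by change 1 / ε * t < _; linarith)
          have h2 : v' y = 0 := hw'.eq_zero _ (by change 1 / ε * t < _; linarith)
          exact ⟨h1.trans h2.symm, Or.inl h1⟩
      have hi : interpolate χ v v' y = v y := by
        rw [interpolate, ← hvv.1]; ring
      have hg : ‖ε • gradient (interpolate χ v v') y‖ = 0 := by
        rw [norm_smul, norm_gradient, fderiv_interpolate hχ hv hv', hd, hd', hvv.1]
        simp
      rw [hi, hg, Real.zero_rpow hp.ne', (hW.eq_zero_iff _).2 hvv.2]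
      simp
  have hvol : volume (Sl ∩ (A \ K)) =
      ENNReal.ofReal (2 * (T * ε) * (ρ ^ (n - 1) - r ^ (n - 1))) := by
    have e : Sl ∩ (A \ K) = (Sl ∩ A) \ (Sl ∩ K) := by
      ext y; simp only [Set.mem_inter_iff, Set.mem_sdiff]; tauto
    rw [e, measure_sdiff (Set.inter_subset_inter_right _ hKA) (hSl.inter hKm).nullMeasurableSet,
      volume_cube_inter_slab hn hR ν hρ x (by linarith),
      volume_cube_inter_slab hn hR ν hr x hTε, ← ENNReal.ofReal_mul (by positivity),
      ← ENNReal.ofReal_mul (by positivity), ← ENNReal.ofReal_sub _ (by positivity)]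
    · ring_nf
    · rw [volume_cube_inter_slab hn hR ν hr x hTε]
      exact ENNReal.mul_ne_top ENNReal.ofReal_ne_top ENNReal.ofReal_ne_top
  calc _ ≤ ENNReal.ofReal (1 / ε) *
        ∫⁻ y in A \ K, Sl.indicator (fun _ => ENNReal.ofReal C) y := by
        gcongr; exact hpt _
    _ = ENNReal.ofReal (1 / ε) * (ENNReal.ofReal C *
          ENNReal.ofReal (2 * (T * ε) * (ρ ^ (n - 1) - r ^ (n - 1)))) := by
        rw [lintegral_indicator hSl, Measure.restrict_restrict hSl, setLIntegral_const, hvol]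
    _ = _ := by
        rw [← ENNReal.ofReal_mul hC, ← ENNReal.ofReal_mul (by positivity)]
        congr 1
        field_simp

/-! ### Mollification and the chain rule -/

/-- Almost everywhere convergence without gain of mass implies convergence in `L¹`. -/
theorem tendsto_integral_abs_sub_of_integral_abs_le {α : Type*} [MeasurableSpace α] {μ : Measure α}
    {F : ℕ → α → ℝ} {h : α → ℝ} (hF : ∀ k, Integrable (F k) μ) (hh : Integrable h μ)
    (hle : ∀ k, ∫ y, |F k y| ∂μ ≤ ∫ y, |h y| ∂μ)
    (hlim : ∀ᵐ y ∂μ, Tendsto (fun k => F k y) atTop (𝓝 (h y))) :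
    Tendsto (fun k => ∫ y, |F k y - h y| ∂μ) atTop (𝓝 0) := by
  have key : Tendsto (fun k => ∫ y, (|F k y| - |F k y - h y|) ∂μ) atTop (𝓝 (∫ y, |h y| ∂μ)) := by
    refine tendsto_integral_of_dominated_convergence (fun y => |h y|) (fun k => ?_) hh.abs
      (fun k => Eventually.of_forall fun y => ?_) ?_
    · exact ((hF k).abs.sub ((hF k).sub hh).abs).aestronglyMeasurable
    · rw [Real.norm_eq_abs]
      simpa using abs_abs_sub_abs_le_abs_sub (F k y) (F k y - h y)
    · filter_upwards [hlim] with y hy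
      have := hy.abs.sub (hy.sub_const (h y)).abs
      simpa using this
  have h0 : Tendsto (fun k => (∫ y, |h y| ∂μ) - ∫ y, (|F k y| - |F k y - h y|) ∂μ) atTop (𝓝 0) := by
    simpa using key.const_sub (∫ y, |h y| ∂μ)
  refine squeeze_zero (fun k => integral_nonneg fun y => abs_nonneg _) (fun k => ?_) h0
  have : ∫ y, (|F k y| - |F k y - h y|) ∂μ = (∫ y, |F k y| ∂μ) - ∫ y, |F k y - h y| ∂μ :=
    integral_sub (hF k).abs ((hF k).sub hh).abs
  rw [this]
  linarith [hle k]

theorem HasSobolevGradient.weak_inner {p : ℝ} (hp : 1 ≤ p) {z : E n → ℝ} {h : E n → E n}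
    (hz : HasSobolevGradient p Set.univ z h) (e : E n) {φ : E n → ℝ} (hφ : ContDiff ℝ ∞ φ)
    (hc : HasCompactSupport φ) : ∫ y, z y * fderiv ℝ φ y e = - ∫ y, inner ℝ (h y) e * φ y := by
  have hd : ∀ y, fderiv ℝ φ y e =
      ∑ i, e i * fderiv ℝ φ y (EuclideanSpace.single i 1) := fun y => by
    have he : e = ∑ i, e i • EuclideanSpace.single i (1 : ℝ) := by
      ext j; simp [Finset.sum_apply, Pi.single_apply]
    conv_lhs => rw [he]
    simp
  have hi : ∀ y, inner ℝ (h y) e = ∑ i, e i * h y i := fun y => by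
    simp [PiLp.inner_apply]
  simp only [hd, hi, Finset.mul_sum, Finset.sum_mul]
  have e1 : ∀ y i, z y * (e i * fderiv ℝ φ y (EuclideanSpace.single i 1)) =
      e i * (z y * fderiv ℝ φ y (EuclideanSpace.single i 1)) := fun y i => by ring
  have e2 : ∀ y i, e i * h y i * φ y = e i * (h y i * φ y) := fun y i => by ring
  simp only [e1, e2]
  have i1 : ∀ i, Integrable (fun y => z y * fderiv ℝ φ y (EuclideanSpace.single i 1)) := fun i => by
    simpa using HasSobolevGradient.integrable_mul hp hz.memLp (continuous_partial hφ i)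
      (hasCompactSupport_partial hc i)
  have i2 : ∀ i, Integrable (fun y => h y i * φ y) := fun i => by
    simpa using HasSobolevGradient.integrable_mul hp (hz.memLp_apply i) hφ.continuous hc
  rw [integral_finsetSum _ fun i _ => (i1 i).const_mul _,
    integral_finsetSum _ fun i _ => (i2 i).const_mul _, ← Finset.sum_neg_distrib]
  refine Finset.sum_congr rfl fun i _ => ?_
  rw [integral_const_mul, integral_const_mul]
  have := hz.weak φ hφ hc (Set.subset_univ _) i
  simp only [Measure.restrict_univ] at this
  rw [this]; ring

open ContinuousLinearMap in
/-- Mollification commutes with weak differentiation. -/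
theorem fderiv_convolution_apply {p : ℝ} (hp : 1 ≤ p) {z : E n → ℝ} {h : E n → E n}
    (hz : HasSobolevGradient p Set.univ z h) (e : E n) {η : E n → ℝ} (hη : ContDiff ℝ ∞ η)
    (hc : HasCompactSupport η) (y : E n) :
    fderiv ℝ (convolution η z (lsmul ℝ ℝ) volume) y e =
      convolution η (fun t => inner ℝ (h t) e) (lsmul ℝ ℝ) volume y := by
  have hl : LocallyIntegrable z := by
    have := hz.memLp.locallyIntegrable (HasSobolevGradient.one_le_ofReal hp)
    simpa using this
  have h1 : ContDiff ℝ 1 η := hη.of_le (by exact_mod_cast le_top)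
  rw [(hc.hasFDerivAt_convolution_left (lsmul ℝ ℝ) h1 hl y).fderiv, convolution_eq_swap,
    convolution_eq_swap]
  have hex := (hc.fderiv ℝ).convolutionExists_left ((lsmul ℝ ℝ).precompL (E n))
    (h1.continuous_fderiv one_ne_zero) hl y
  have hint : Integrable (fun t => (lsmul ℝ ℝ).precompL (E n) (fderiv ℝ η (y - t)) (z t)) := by
    have := hex.integrable_swap
    simpa using this
  rw [ContinuousLinearMap.integral_apply hint]
  have hw := hz.weak_inner hp e (φ := fun t => η (y - t)) (hη.comp (contDiff_const.sub contDiff_id))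
    (hc.comp_homeomorph (Homeomorph.subLeft y))
  have hd : ∀ t, fderiv ℝ (fun t => η (y - t)) t e = - fderiv ℝ η (y - t) e := fun t => by
    have := ((h1.differentiable one_ne_zero (y - t)).hasFDerivAt.comp t
      ((hasFDerivAt_id t).const_sub y)).fderiv
    change fderiv ℝ (η ∘ fun t => y - t) t e = _
    have h' : fderiv ℝ (η ∘ fun t => y - t) t = (fderiv ℝ η (y - t)).comp
      (-ContinuousLinearMap.id ℝ (E n)) := this
    rw [h']; simp
  simp only [hd, mul_neg, integral_neg, neg_inj] at hw
  simp only [precompL_apply, lsmul_apply, smul_eq_mul]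
  calc _ = ∫ t, z t * fderiv ℝ η (y - t) e := integral_congr_ae (Eventually.of_forall fun t => by
        simp [mul_comm])
    _ = _ := hw
    _ = _ := integral_congr_ae (Eventually.of_forall fun t => by simp [mul_comm])

open ContinuousLinearMap in
/-- Smooth approximation of a compactly supported Sobolev function and of its derivative in the
direction `e`. -/
theorem exists_mollification {p : ℝ} (hp : 1 ≤ p) {z : E n → ℝ} {h : E n → E n}
    (hz : HasSobolevGradient p Set.univ z h) {r : ℝ}
    (hz0 : ∀ y ∉ Metric.closedBall (0 : E n) r, z y = 0)
    (hh0 : ∀ y ∉ Metric.closedBall (0 : E n) r, h y = 0) (e : E n) :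
    ∃ Z : ℕ → E n → ℝ, (∀ k, ContDiff ℝ ∞ (Z k)) ∧
      (∀ k, ∀ y ∉ Metric.closedBall (0 : E n) (r + 1), Z k y = 0) ∧
      (∀ᵐ y, Tendsto (fun k => Z k y) atTop (𝓝 (z y))) ∧
      (∀ k, Integrable fun y => fderiv ℝ (Z k) y e) ∧
      Integrable (fun y => (inner ℝ (h y) e : ℝ)) ∧
      Tendsto (fun k => ∫ y, |fderiv ℝ (Z k) y e - inner ℝ (h y) e|) atTop (𝓝 0) := by
  have hp' := HasSobolevGradient.one_le_ofReal hp
  have hzl : LocallyIntegrable z := by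
    have := hz.memLp.locallyIntegrable hp'
    simpa using this
  have hhi : Integrable h := by
    have h1 : LocallyIntegrable h := by
      have := hz.memLp_grad.locallyIntegrable hp'
      simpa using this
    refine (integrableOn_iff_integrable_of_support_subset (s := Metric.closedBall 0 r) ?_).1
      (h1.integrableOn_isCompact (isCompact_closedBall _ _))
    exact fun y hy => by by_contra hn; exact hy (hh0 y hn)
  have hei : Integrable (fun y => (inner ℝ (h y) e : ℝ)) := hhi.inner_const e
  let φ : ℕ → ContDiffBump (0 : E n) := fun k =>
    ⟨1 / (2 * ((k : ℝ) + 1)), 1 / ((k : ℝ) + 1), by positivity, by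
      apply one_div_lt_one_div_of_lt <;> linarith [(Nat.cast_nonneg k : (0 : ℝ) ≤ k)]⟩
  have hφ : Tendsto (fun k => (φ k).rOut) atTop (𝓝 0) := tendsto_one_div_add_atTop_nhds_zero_nat
  have hφ' : ∀ᶠ k in atTop, (φ k).rOut ≤ 2 * (φ k).rIn := Eventually.of_forall fun k => by
    change 1 / ((k : ℝ) + 1) ≤ 2 * (1 / (2 * ((k : ℝ) + 1)))
    apply le_of_eq; field_simp
  have hη : ∀ k, ContDiff ℝ ∞ ((φ k).normed volume) := fun k => (φ k).contDiff_normed (n := ⊤)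
  have hηc : ∀ k, HasCompactSupport ((φ k).normed volume) := fun k => (φ k).hasCompactSupport_normed
  have hfd : ∀ k y, fderiv ℝ (convolution ((φ k).normed volume) z (lsmul ℝ ℝ) volume) y e =
      convolution ((φ k).normed volume) (fun t => inner ℝ (h t) e) (lsmul ℝ ℝ) volume y :=
    fun k y => fderiv_convolution_apply hp hz e (hη k) (hηc k) y
  refine ⟨fun k => convolution ((φ k).normed volume) z (lsmul ℝ ℝ) volume, fun k => ?_,
    fun k y hy => ?_, ?_, fun k => ?_, hei, ?_⟩
  · exact (hηc k).contDiff_convolution_left (n := ⊤) (lsmul ℝ ℝ) (hη k) hzl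
  · by_contra hne
    obtain ⟨a, ha, b, hb, rfl⟩ := support_convolution_subset (lsmul ℝ ℝ) hne
    rw [(φ k).support_normed_eq] at ha
    have hb' : b ∈ Metric.closedBall (0 : E n) r := by
      by_contra hn; exact hb (hz0 b hn)
    rw [mem_ball_zero_iff] at ha
    rw [mem_closedBall_zero_iff] at hb'
    apply hy
    rw [mem_closedBall_zero_iff]
    have h1 : (φ k).rOut ≤ 1 := by
      change 1 / ((k : ℝ) + 1) ≤ 1
      rw [div_le_one (by positivity)]
      linarith [(Nat.cast_nonneg k : (0 : ℝ) ≤ k)]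
    linarith [norm_add_le a b]
  · exact ContDiffBump.ae_convolution_tendsto_right_of_locallyIntegrable hφ hφ' hzl
  · simp only [hfd]
    exact (φ k).integrable_normed.integrable_convolution (lsmul ℝ ℝ) hei
  · simp only [hfd]
    refine tendsto_integral_abs_sub_of_integral_abs_le (fun k =>
      (φ k).integrable_normed.integrable_convolution (lsmul ℝ ℝ) hei) hei (fun k => ?_)
      (ContDiffBump.ae_convolution_tendsto_right_of_locallyIntegrable hφ hφ' hei.locallyIntegrable)
    have hI := integral_convolution (μ := volume) (lsmul ℝ ℝ)
      ((φ k).integrable_normed (μ := volume)) hei.abs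
    rw [(φ k).integral_normed] at hI
    calc _ ≤ ∫ y, convolution ((φ k).normed volume) (fun t => |inner ℝ (h t) e|) (lsmul ℝ ℝ)
          volume y := by
          refine integral_mono
            ((φ k).integrable_normed.integrable_convolution (lsmul ℝ ℝ) hei).abs
            ((φ k).integrable_normed.integrable_convolution (lsmul ℝ ℝ) hei.abs) fun y => ?_
          simp only [convolution, lsmul_apply, smul_eq_mul]
          refine abs_integral_le_integral_abs.trans (le_of_eq ?_)
          refine integral_congr_ae (Eventually.of_forall fun t => ?_)
          simp [abs_mul, abs_of_nonneg ((φ k).nonneg_normed (μ := volume) t)]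
      _ = _ := by rw [hI]; simp

/-- The integral of the derivative of `Φ ∘ u` in the direction `e` depends only on the boundary
values of `u`: replacing `v` by `v + z` with `z` compactly supported does not change it. -/
theorem integral_comp_mul_inner_eq_zero {p : ℝ} (hp : 1 ≤ p) {z : E n → ℝ} {h : E n → E n}
    (hz : HasSobolevGradient p Set.univ z h) {r : ℝ}
    (hz0 : ∀ y ∉ Metric.closedBall (0 : E n) r, z y = 0)
    (hh0 : ∀ y ∉ Metric.closedBall (0 : E n) r, h y = 0) (e : E n) {Φ G : ℝ → ℝ} {M : ℝ}
    (hG : Continuous G) (hGM : ∀ t, |G t| ≤ M) (hΦ : ∀ t, HasDerivAt Φ (G t) t)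
    {v : E n → ℝ} (hv : ContDiff ℝ 1 v) :
    Integrable (fun y => (G (v y + z y) - G (v y)) * fderiv ℝ v y e +
      G (v y + z y) * inner ℝ (h y) e) ∧
    ∫ y, ((G (v y + z y) - G (v y)) * fderiv ℝ v y e + G (v y + z y) * inner ℝ (h y) e) = 0 := by
  obtain ⟨Z, hZs, hZ0, hZz, hZi, hhi, hZh⟩ := exists_mollification hp hz hz0 hh0 e
  set B := Metric.closedBall (0 : E n) (r + 1)
  have hB : IsCompact B := isCompact_closedBall _ _
  have hM : 0 ≤ M := (abs_nonneg _).trans (hGM 0)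
  have hdv : Continuous fun y => fderiv ℝ v y e :=
    (hv.continuous_fderiv one_ne_zero).clm_apply continuous_const
  have hZd : ∀ k, ContDiff ℝ 1 (Z k) := fun k => (hZs k).of_le (by exact_mod_cast le_top)
  have hΦ1 : ContDiff ℝ 1 Φ := by
    rw [contDiff_one_iff_deriv]
    refine ⟨fun t => (hΦ t).differentiableAt, ?_⟩
    have : deriv Φ = G := funext fun t => (hΦ t).deriv
    rwa [this]
  have hzm : AEStronglyMeasurable z := by
    simpa using hz.memLp.aestronglyMeasurable
  have hBsub : ∀ y, y ∉ B → y ∉ Metric.closedBall (0 : E n) r := fun y hy hy' =>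
    hy (Metric.closedBall_subset_closedBall (by linarith) hy')
  -- The identity for the smooth approximations.
  have hsmooth : ∀ k, ∫ y, ((G (v y + Z k y) - G (v y)) * fderiv ℝ v y e +
      G (v y + Z k y) * fderiv ℝ (Z k) y e) = 0 := by
    intro k
    set ψ : E n → ℝ := fun y => Φ (v y + Z k y) - Φ (v y)
    have hψ : ContDiff ℝ 1 ψ := (hΦ1.comp (hv.add (hZd k))).sub (hΦ1.comp hv)
    have hψd : ∀ y, fderiv ℝ ψ y e = (G (v y + Z k y) - G (v y)) * fderiv ℝ v y e +
        G (v y + Z k y) * fderiv ℝ (Z k) y e := fun y => by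
      have a1 := (hv.differentiable one_ne_zero y).hasFDerivAt
      have a2 := ((hZd k).differentiable one_ne_zero y).hasFDerivAt
      have := ((hΦ (v y + Z k y)).comp_hasFDerivAt y (a1.add a2)).sub
        ((hΦ (v y)).comp_hasFDerivAt y a1)
      have e' : ψ = (Φ ∘ (v + Z k)) - (Φ ∘ v) := rfl
      rw [e', this.fderiv]
      simp; ring
    have hψ0 : ∀ y, y ∉ B → ψ y = 0 := fun y hy => by simp [ψ, hZ0 k y hy]
    have hψc : HasCompactSupport ψ := HasCompactSupport.intro hB hψ0
    have hψdc : Continuous fun y => fderiv ℝ ψ y e :=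
      (hψ.continuous_fderiv one_ne_zero).clm_apply continuous_const
    have hψdi : Integrable fun y => fderiv ℝ ψ y e :=
      hψdc.integrable_of_hasCompactSupport (hψc.fderiv_apply ℝ e)
    have := integral_mul_fderiv_eq_neg_fderiv_mul_of_integrable (μ := (volume : Measure (E n)))
      (f := fun _ => (1 : ℝ)) (g := ψ) (v := e) (by simp) (by simpa using hψdi)
      (by simpa using hψ.continuous.integrable_of_hasCompactSupport hψc)
      (fun y _ => differentiableAt_const _) (fun y _ => hψ.differentiable one_ne_zero y)
    simp only [fderiv_fun_const, Pi.zero_apply, zero_apply, zero_mul, integral_zero, neg_zero,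
      one_mul] at this
    rw [← this]
    exact integral_congr_ae (Eventually.of_forall fun y => (hψd y).symm)
  -- The part that converges by dominated convergence.
  set bound : E n → ℝ := fun y => B.indicator (fun y => 2 * M * |fderiv ℝ v y e|) y +
    M * |inner ℝ (h y) e|
  have hbi : Integrable bound := by
    refine Integrable.add ?_ (hhi.abs.const_mul M)
    rw [integrable_indicator_iff hB.measurableSet]
    exact (continuous_const.mul hdv.abs).continuousOn.integrableOn_compact hB
  have hbd : ∀ (Y : E n → ℝ), (∀ y ∉ B, Y y = 0) → ∀ y,
      ‖(G (v y + Y y) - G (v y)) * fderiv ℝ v y e + G (v y + Y y) * inner ℝ (h y) e‖ ≤ bound y := by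
    intro Y hY y
    refine (norm_add_le _ _).trans (add_le_add ?_ ?_)
    · by_cases hy : y ∈ B
      · rw [Set.indicator_of_mem hy, norm_mul, Real.norm_eq_abs, Real.norm_eq_abs]
        gcongr
        refine (abs_sub _ _).trans ?_
        linarith [hGM (v y + Y y), hGM (v y)]
      · rw [Set.indicator_of_notMem hy, hY y hy]; simp
    · rw [norm_mul, Real.norm_eq_abs, Real.norm_eq_abs]
      gcongr
      exact hGM _
  have hmeas : ∀ (Y : E n → ℝ), AEStronglyMeasurable Y → AEStronglyMeasurable fun y =>
      (G (v y + Y y) - G (v y)) * fderiv ℝ v y e + G (v y + Y y) * inner ℝ (h y) e := by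
    intro Y hY
    have h1 : AEStronglyMeasurable fun y => G (v y + Y y) :=
      hG.comp_aestronglyMeasurable (hv.continuous.aestronglyMeasurable.add hY)
    have h2 : AEStronglyMeasurable fun y => G (v y) :=
      (hG.comp hv.continuous).aestronglyMeasurable
    exact ((h1.sub h2).mul hdv.aestronglyMeasurable).add (h1.mul hhi.aestronglyMeasurable)
  have hz0' : ∀ y ∉ B, z y = 0 := fun y hy => hz0 y (hBsub y hy)
  have hintz := hbi.mono' (hmeas z hzm) (Eventually.of_forall (hbd z hz0'))
  have hintZ : ∀ k, Integrable fun y => (G (v y + Z k y) - G (v y)) * fderiv ℝ v y e +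
      G (v y + Z k y) * inner ℝ (h y) e := fun k =>
    hbi.mono' (hmeas (Z k) (hZs k).continuous.aestronglyMeasurable)
      (Eventually.of_forall (hbd (Z k) (hZ0 k)))
  have hlim1 := tendsto_integral_of_dominated_convergence (μ := (volume : Measure (E n)))
    (F := fun k y => (G (v y + Z k y) - G (v y)) * fderiv ℝ v y e +
      G (v y + Z k y) * inner ℝ (h y) e)
    (f := fun y => (G (v y + z y) - G (v y)) * fderiv ℝ v y e + G (v y + z y) * inner ℝ (h y) e)
    bound (fun k => hmeas (Z k) (hZs k).continuous.aestronglyMeasurable) hbi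
    (fun k => Eventually.of_forall (hbd (Z k) (hZ0 k))) (by
      filter_upwards [hZz] with y hy
      have h1 : Tendsto (fun k => G (v y + Z k y)) atTop (𝓝 (G (v y + z y))) :=
        (hG.tendsto _).comp (hy.const_add (v y))
      exact ((h1.sub_const _).mul_const _).add (h1.mul_const _))
  -- The error made by replacing the derivative of the approximation.
  have hlim2 : Tendsto (fun k => ∫ y, ((G (v y + Z k y) - G (v y)) * fderiv ℝ v y e +
      G (v y + Z k y) * inner ℝ (h y) e)) atTop (𝓝 0) := by
    have hMZ : Tendsto (fun k => M * ∫ y, |fderiv ℝ (Z k) y e - inner ℝ (h y) e|) atTop (𝓝 0) := by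
      simpa using hZh.const_mul M
    refine squeeze_zero_norm (fun k => ?_) hMZ
    have hdi : Integrable fun y => fderiv ℝ (Z k) y e - inner ℝ (h y) e := (hZi k).sub hhi
    have herr : Integrable fun y => G (v y + Z k y) * (fderiv ℝ (Z k) y e - inner ℝ (h y) e) :=
      hdi.bdd_mul (hG.comp (hv.continuous.add (hZs k).continuous)).aestronglyMeasurable
        (Eventually.of_forall fun y => hGM _)
    have e1 : ∫ y, ((G (v y + Z k y) - G (v y)) * fderiv ℝ v y e +
        G (v y + Z k y) * inner ℝ (h y) e) =
        - ∫ y, G (v y + Z k y) * (fderiv ℝ (Z k) y e - inner ℝ (h y) e) := by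
      have := integral_add (hintZ k) herr
      have e2 := hsmooth k
      rw [← add_eq_zero_iff_eq_neg, ← this, ← e2]
      refine integral_congr_ae (Eventually.of_forall fun y => ?_)
      simp only
      ring
    rw [e1, norm_neg, ← integral_const_mul]
    refine norm_integral_le_of_norm_le (hdi.abs.const_mul M) (Eventually.of_forall fun y => ?_)
    rw [norm_mul, Real.norm_eq_abs, Real.norm_eq_abs]
    gcongr
    exact hGM _
  exact ⟨hintz, tendsto_nhds_unique hlim1 hlim2⟩

/-! ### The lower bound -/

/-- The constant for which `factor p * a ^ ((p - 1) / p) * b ≤ a + b ^ p` is sharp. -/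
def factor (p : ℝ) : ℝ := p * (p - 1) ^ ((1 - p) / p)

theorem factor_pos {p : ℝ} (hp : 1 < p) : 0 < factor p :=
  mul_pos (by linarith) (Real.rpow_pos_of_pos (by linarith) _)

/-- Young's inequality with the sharp constant. -/
theorem factor_mul_le {p : ℝ} (hp : 1 < p) {a b : ℝ} (ha : 0 ≤ a) (hb : 0 ≤ b) :
    factor p * a ^ ((p - 1) / p) * b ≤ a + b ^ p := by
  have hp0 : 0 < p := by linarith
  have hp1 : 0 < p - 1 := by linarith
  set q := p / (p - 1)
  have hq : 0 < q := by positivity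
  have hpq : p.HolderConjugate q := Real.HolderConjugate.conjExponent hp
  have hqi : 1 / q = (p - 1) / p := by simp [q]
  have hy := Real.young_inequality_of_nonneg (a := p ^ (1 / p) * b) (b := (q * a) ^ (1 / q))
    (by positivity) (by positivity) hpq
  rw [Real.mul_rpow (by positivity) hb, ← Real.rpow_mul hp0.le, ← Real.rpow_mul (by positivity),
    one_div_mul_cancel hp0.ne', one_div_mul_cancel hq.ne', Real.rpow_one, Real.rpow_one,
    mul_div_cancel_left₀ _ hp0.ne', mul_div_cancel_left₀ _ hq.ne', hqi,
    Real.mul_rpow hq.le ha] at hy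
  have hk : p ^ (1 / p) * q ^ ((p - 1) / p) = factor p := by
    rw [factor, Real.div_rpow hp0.le hp1.le, ← mul_div_assoc, ← Real.rpow_add hp0, ← add_div,
      show 1 + (p - 1) = p by ring, div_self hp0.ne', Real.rpow_one, div_eq_mul_inv,
      ← Real.rpow_neg hp1.le]
    congr 2; ring
  calc factor p * a ^ ((p - 1) / p) * b
      = p ^ (1 / p) * b * (q ^ ((p - 1) / p) * a ^ ((p - 1) / p)) := by rw [← hk]; ring
    _ ≤ b ^ p + a := hy
    _ = a + b ^ p := add_comm _ _

/-- Equality holds in `factor_mul_le` when `b ^ p = a / (p - 1)`. -/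
theorem factor_mul_eq {p : ℝ} (hp : 1 < p) {a : ℝ} (ha : 0 < a) :
    a + ((a / (p - 1)) ^ (1 / p)) ^ p =
      factor p * a ^ ((p - 1) / p) * (a / (p - 1)) ^ (1 / p) := by
  have hp0 : 0 < p := by linarith
  have hp1 : 0 < p - 1 := by linarith
  rw [← Real.rpow_mul (by positivity), one_div_mul_cancel hp0.ne', Real.rpow_one, factor,
    Real.div_rpow ha.le hp1.le]
  have h1 : a ^ ((p - 1) / p) * a ^ (1 / p) = a := by
    rw [← Real.rpow_add ha, ← add_div, sub_add_cancel, div_self hp0.ne', Real.rpow_one]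
  have h2 : (p - 1) ^ ((1 - p) / p) / (p - 1) ^ (1 / p) = 1 / (p - 1) := by
    rw [← Real.rpow_sub hp1, ← sub_div, show (1 - p - 1) / p = -1 by field_simp; ring,
      Real.rpow_neg_one, one_div]
  calc a + a / (p - 1) = p * a * (1 / (p - 1)) := by field_simp; ring
    _ = p * (a ^ ((p - 1) / p) * a ^ (1 / p)) * ((p - 1) ^ ((1 - p) / p) / (p - 1) ^ (1 / p)) := by
        rw [h1, h2]
    _ = _ := by ring

/-- The density `W ^ ((p - 1) / p)`, extended from `[0, 1]` to a bounded function on the line. -/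
def tensionDensity (W : ℝ → ℝ) (p t : ℝ) : ℝ := W (max 0 (min t 1)) ^ ((p - 1) / p)

theorem clamp_mem_Icc (t : ℝ) : max 0 (min t 1) ∈ Set.Icc (0 : ℝ) 1 :=
  ⟨le_max_left _ _, max_le zero_le_one (min_le_right _ _)⟩

theorem clamp_of_mem_Icc {t : ℝ} (ht : t ∈ Set.Icc (0 : ℝ) 1) : max 0 (min t 1) = t := by
  rw [min_eq_left ht.2, max_eq_right ht.1]

theorem IsDoubleWell.exists_bound {W : ℝ → ℝ} (hW : IsDoubleWell W) :
    ∃ M, 0 ≤ M ∧ ∀ t ∈ Set.Icc (0 : ℝ) 1, W t ≤ M := by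
  obtain ⟨M, hM⟩ := (isCompact_Icc.image hW.continuous).isBounded.exists_norm_le
  have h : ∀ t ∈ Set.Icc (0 : ℝ) 1, W t ≤ M := fun t ht => (le_abs_self _).trans (hM _ ⟨t, ht, rfl⟩)
  exact ⟨M, (hW.nonneg 0).trans (h 0 ⟨le_rfl, zero_le_one⟩), h⟩

theorem continuous_tensionDensity (hW : IsDoubleWell W) (hp : 1 < p) :
    Continuous (tensionDensity W p) := by
  have : 0 ≤ (p - 1) / p := div_nonneg (by linarith) (by linarith)
  unfold tensionDensity
  exact (hW.continuous.comp (by fun_prop)).rpow_const fun t => Or.inr this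

theorem tensionDensity_nonneg (hW : IsDoubleWell W) (t : ℝ) : 0 ≤ tensionDensity W p t :=
  Real.rpow_nonneg (hW.nonneg _) _

theorem exists_bound_tensionDensity (hW : IsDoubleWell W) (hp : 1 < p) :
    ∃ M, ∀ t, |tensionDensity W p t| ≤ M := by
  obtain ⟨M, -, hM⟩ := hW.exists_bound
  refine ⟨M ^ ((p - 1) / p), fun t => ?_⟩
  rw [abs_of_nonneg (tensionDensity_nonneg hW t)]
  exact Real.rpow_le_rpow (hW.nonneg _) (hM _ (clamp_mem_Icc t))
    (div_nonneg (by linarith) (by linarith))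

theorem factor_mul_integral_tensionDensity :
    factor p * ∫ t in (0 : ℝ)..1, tensionDensity W p t = surfaceTension W p := by
  rw [surfaceTension, factor]
  congr 1
  refine intervalIntegral.integral_congr fun t ht => ?_
  rw [Set.uIcc_of_le zero_le_one] at ht
  simp only [tensionDensity, clamp_of_mem_Icc ht]

/-- The integral over a cube of the derivative of `Φ ∘ u` across the interface, when `u` is the
boundary datum and `Φ` a primitive of `G`. -/
theorem integral_boundaryDatum (hn : 0 < n) (hR : IsRotationFamily n R) (ν : S n) {ρ ε T : ℝ}
    (hρ : 0 < ρ) (hε : 0 < ε) (hTε : T * ε < ρ / 2) (x : E n) {w : ℝ → ℝ} (hw : IsTransition T w)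
    {G : ℝ → ℝ} (hG : Continuous G) :
    ∫ y in cube R ν ρ x, G (boundaryDatum w ε x ν y) *
      fderiv ℝ (boundaryDatum w ε x ν) y (ν : E n) = ρ ^ (n - 1) * ∫ t in (0 : ℝ)..1, G t := by
  set H : ℝ → ℝ := fun t => G (w (1 / ε * t)) * (1 / ε * deriv w (1 / ε * t))
  have hdw : Continuous (deriv w) := hw.contDiff.continuous_deriv le_rfl
  have hH : Continuous H := by
    have := hw.contDiff.continuous
    fun_prop
  have hν : ‖(ν : E n)‖ = 1 := by simp
  have e1 : ∀ y, G (boundaryDatum w ε x ν y) * fderiv ℝ (boundaryDatum w ε x ν) y (ν : E n) =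
      H (inner ℝ (y - x) (ν : E n)) := fun y => by
    rw [← inner_gradient_left, (hasGradientAt_boundaryDatum hw.contDiff ε x ν y).gradient,
      real_inner_smul_left, real_inner_self_eq_norm_sq, hν]
    simp [H, boundaryDatum]
  have hm : Measurable fun y : E n => (inner ℝ (y - x) (ν : E n) : ℝ) := by fun_prop
  simp only [e1]
  rw [← integral_map hm.aemeasurable hH.aestronglyMeasurable,
    map_inner_restrict_cube hn hR ν hρ x, integral_smul_measure, smul_eq_mul,
    ENNReal.toReal_ofReal (by positivity), ← integral_Ioc_eq_integral_Ioo,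
    ← intervalIntegral.integral_of_le (by linarith)]
  congr 1
  set Φ : ℝ → ℝ := fun s => ∫ t in (0 : ℝ)..s, G t
  have hΦ : ∀ s, HasDerivAt Φ (G s) s := fun s => (hG.integral_hasStrictDerivAt 0 s).hasDerivAt
  have hd : ∀ t, HasDerivAt (fun t => Φ (w (1 / ε * t))) (H t) t := fun t => by
    have h1 := ((hw.contDiff.differentiable one_ne_zero) (1 / ε * t)).hasDerivAt
    have h2 := (hasDerivAt_id t).const_mul (1 / ε)
    have h3 := (hΦ _).comp t (h1.comp t h2)
    refine h3.congr_deriv ?_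
    simp only [H, Function.comp_apply]; ring
  rw [intervalIntegral.integral_eq_sub_of_hasDerivAt (fun t _ => hd t) (hH.intervalIntegrable _ _)]
  have ht : T < 1 / ε * (ρ / 2) := by
    rw [one_div, lt_inv_mul_iff₀ hε]; linarith
  rw [hw.eq_one _ ht, hw.eq_zero _ (by linarith)]
  simp [Φ]

theorem ofReal_integral_le_lintegral {α : Type*} [MeasurableSpace α] {μ : Measure α} {F : α → ℝ}
    (hF : Integrable F μ) : ENNReal.ofReal (∫ y, F y ∂μ) ≤ ∫⁻ y, ENNReal.ofReal (F y) ∂μ := by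
  refine ENNReal.ofReal_le_of_le_toReal ?_
  rw [integral_eq_lintegral_pos_part_sub_lintegral_neg_part hF]
  linarith [@ENNReal.toReal_nonneg (∫⁻ y, ENNReal.ofReal (-F y) ∂μ)]

/-- The lower bound, uniform among all competitors: by Young's inequality the energy is bounded from
below by the integral of a derivative, which is determined by the boundary datum. -/
theorem le_minEnergy (hn : 0 < n) (hR : IsRotationFamily n R) (ν : S n) {ρ ε T : ℝ}
    (hρ : 0 < ρ) (hε : 0 < ε) (hTε : T * ε < ρ / 2) (x : E n) {w : ℝ → ℝ} (hw : IsTransition T w)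
    (hW : IsDoubleWell W) (hp : 1 < p) (hc₁ : 0 ≤ c₁) {f : E n → ℝ → E n → ℝ}
    (hf : IsIntegrand W p c₁ c₂ f) :
    ENNReal.ofReal (c₁ * surfaceTension W p * ρ ^ (n - 1)) ≤
      minEnergy f ε p (boundaryDatum w ε x ν) (cube R ν ρ x) := by
  set A := cube R ν ρ x
  have hA : IsOpen A := isOpen_cube hR ν hρ x
  set v := boundaryDatum w ε x ν
  have hv : ContDiff ℝ 1 v := contDiff_boundaryDatum hw.contDiff ε x ν
  set G := tensionDensity W p
  have hG : Continuous G := continuous_tensionDensity hW hp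
  obtain ⟨M, hM⟩ := exists_bound_tensionDensity hW hp
  refine le_iInf₂ fun u hu => ?_
  obtain ⟨r, z, h, hr, hrρ, hz, hz0, hh0, huz, hsob⟩ :=
    exists_decomposition_of_mem_admissible hR ν hp.le hρ x hv hu
  rw [energy_eq f ε hp.le hA hsob hu.1.2]
  have hKA : cube R ν r x ⊆ A := cube_subset_cube hR ν hr hrρ.le x
  obtain ⟨r', hr'⟩ := (isBounded_cube hR ν hr x).subset_closedBall 0
  obtain ⟨hi, hI⟩ := integral_comp_mul_inner_eq_zero hp.le hz
    (fun y hy => hz0 y fun h => hy (hr' h)) (fun y hy => hh0 y fun h => hy (hr' h)) (ν : E n)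
    (Φ := fun s => ∫ t in (0 : ℝ)..s, G t) hG hM
    (fun s => (hG.integral_hasStrictDerivAt 0 s).hasDerivAt) hv
  have hdv : Continuous fun y => fderiv ℝ v y (ν : E n) :=
    (hv.continuous_fderiv one_ne_zero).clm_apply continuous_const
  have hiv : IntegrableOn (fun y => G (v y) * fderiv ℝ v y (ν : E n)) A :=
    ((hG.comp hv.continuous).mul hdv).continuousOn.integrableOn_compact
      (isBounded_cube hR ν hρ x).isCompact_closure |>.mono_set subset_closure
  have hIA : ∫ y in A, ((G (v y + z y) - G (v y)) * fderiv ℝ v y (ν : E n) +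
      G (v y + z y) * inner ℝ (h y) (ν : E n)) = 0 := by
    rw [setIntegral_eq_integral_of_forall_compl_eq_zero, hI]
    intro y hy
    have hyK : y ∉ cube R ν r x := fun h => hy (hKA h)
    simp [hz0 y hyK, hh0 y hyK]
  have hsum : ∫ y in A, G (v y + z y) * inner ℝ (gradient v y + h y) (ν : E n) =
      ρ ^ (n - 1) * ∫ t in (0 : ℝ)..1, G t := by
    have hadd := integral_add (hi.integrableOn (s := A)) hiv
    rw [hIA, zero_add] at hadd
    rw [← integral_boundaryDatum hn hR ν hρ hε hTε x hw hG, ← hadd]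
    refine integral_congr_ae (Eventually.of_forall fun y => ?_)
    simp only [inner_add_left, inner_gradient_left]
    ring
  have hint : IntegrableOn (fun y => G (v y + z y) * inner ℝ (gradient v y + h y) (ν : E n)) A := by
    refine (hi.integrableOn.add hiv).congr (Eventually.of_forall fun y => ?_)
    simp only [Pi.add_apply, inner_add_left, inner_gradient_left]
    ring
  have hfac := (factor_pos hp).le
  have hpt : ∀ᵐ y ∂(volume.restrict A), ENNReal.ofReal (c₁ * factor p *
      (G (v y + z y) * inner ℝ (gradient v y + h y) (ν : E n))) ≤
      ENNReal.ofReal (1 / ε) * ENNReal.ofReal (f y (u y) (ε • (gradient v y + h y))) := by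
    filter_upwards [huz, hu.1.2] with y hy hy01
    rw [← ENNReal.ofReal_mul (by positivity)]
    refine ENNReal.ofReal_le_ofReal ?_
    have hGu : G (v y + z y) = W (u y) ^ ((p - 1) / p) := by
      rw [← hy]; simp only [G, tensionDensity, clamp_of_mem_Icc hy01]
    have hin : (inner ℝ (gradient v y + h y) (ν : E n) : ℝ) ≤ ‖gradient v y + h y‖ := by
      have := real_inner_le_norm (gradient v y + h y) (ν : E n)
      simpa using this
    have hyoung := factor_mul_le hp (hW.nonneg (u y)) (norm_nonneg (ε • (gradient v y + h y)))
    have hlow := hf.lower y (u y) (ε • (gradient v y + h y))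
    rw [norm_smul, Real.norm_eq_abs, abs_of_pos hε] at hyoung hlow
    have hWn : 0 ≤ W (u y) ^ ((p - 1) / p) := Real.rpow_nonneg (hW.nonneg _) _
    rw [hGu]
    calc c₁ * factor p * (W (u y) ^ ((p - 1) / p) * inner ℝ (gradient v y + h y) (ν : E n))
        ≤ c₁ * factor p * (W (u y) ^ ((p - 1) / p) * ‖gradient v y + h y‖) := by gcongr
      _ = 1 / ε * (c₁ * (factor p * W (u y) ^ ((p - 1) / p) * (ε * ‖gradient v y + h y‖))) := by
          field_simp
      _ ≤ 1 / ε * f y (u y) (ε • (gradient v y + h y)) := by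
          gcongr
          exact (mul_le_mul_of_nonneg_left hyoung hc₁).trans hlow
  calc ENNReal.ofReal (c₁ * surfaceTension W p * ρ ^ (n - 1))
      = ENNReal.ofReal (∫ y in A, c₁ * factor p *
          (G (v y + z y) * inner ℝ (gradient v y + h y) (ν : E n))) := by
        rw [integral_const_mul, hsum, ← factor_mul_integral_tensionDensity]
        congr 1; ring
    _ ≤ ∫⁻ y in A, ENNReal.ofReal (c₁ * factor p *
          (G (v y + z y) * inner ℝ (gradient v y + h y) (ν : E n))) :=
        ofReal_integral_le_lintegral (hint.const_mul _)
    _ ≤ ∫⁻ y in A, ENNReal.ofReal (1 / ε) *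
          ENNReal.ofReal (f y (u y) (ε • (gradient v y + h y))) := lintegral_mono_ae hpt
    _ = _ := lintegral_const_mul' _ _ ENNReal.ofReal_ne_top

/-! ### Almost optimal profiles -/

/-- The autonomous equation `g' = h(g)` with a positive right-hand side, solved by separation of
variables. -/
theorem exists_solution_autonomous {h : ℝ → ℝ} (hc : Continuous h) {a b : ℝ} (ha : 0 < a)
    (hab : ∀ s, a ≤ h s ∧ h s ≤ b) :
    ∃ (g : ℝ → ℝ) (L : ℝ), 0 < L ∧ g 0 = 0 ∧ g L = 1 ∧ ∀ t, HasDerivAt g (h (g t)) t := by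
  have hb : 0 < b := ha.trans_le ((hab 0).1.trans (hab 0).2)
  have hpos : ∀ s, 0 < h s := fun s => ha.trans_le (hab s).1
  have hci : Continuous fun s => (h s)⁻¹ := hc.inv₀ fun s => (hpos s).ne'
  set G : ℝ → ℝ := fun s => ∫ t in (0 : ℝ)..s, (h t)⁻¹
  have hG : ∀ s, HasDerivAt G (h s)⁻¹ s := fun s => (hci.integral_hasStrictDerivAt 0 s).hasDerivAt
  have hGmono : StrictMono G := strictMono_of_deriv_pos fun s => by
    rw [(hG s).deriv]; exact inv_pos.2 (hpos s)
  have hGc : Continuous G := continuous_iff_continuousAt.2 fun s => (hG s).continuousAt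
  have h0 : G 0 = 0 := by simp [G]
  have hdiff : Monotone fun s => G s - b⁻¹ * s := by
    refine monotone_of_deriv_nonneg (fun s => ?_) fun s => ?_
    · exact ((hG s).sub ((hasDerivAt_id s).const_mul b⁻¹)).differentiableAt
    · have : HasDerivAt (fun s => G s - b⁻¹ * s) ((h s)⁻¹ - b⁻¹ * 1) s :=
        (hG s).sub ((hasDerivAt_id s).const_mul b⁻¹)
      rw [this.deriv, mul_one, sub_nonneg]
      exact inv_anti₀ (hpos s) (hab s).2
  have htop : Tendsto G atTop atTop := by
    refine tendsto_atTop_mono' _ ?_ (tendsto_id.const_mul_atTop (inv_pos.2 hb))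
    filter_upwards [eventually_ge_atTop 0] with s hs
    have := hdiff hs
    simp only [h0, mul_zero, sub_zero] at this
    simp only [id]; linarith
  have hbot : Tendsto G atBot atBot := by
    refine tendsto_atBot_mono' _ ?_ (tendsto_id.const_mul_atBot (inv_pos.2 hb))
    filter_upwards [eventually_le_atBot 0] with s hs
    have := hdiff hs
    simp only [h0, mul_zero, sub_zero] at this
    simp only [id]; linarith
  set e : ℝ ≃o ℝ := hGmono.orderIsoOfSurjective G (hGc.surjective htop hbot)
  have he : ∀ t, G (e.symm t) = t := fun t => e.apply_symm_apply t
  refine ⟨e.symm, G 1, ?_, ?_, ?_, fun t => ?_⟩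
  · rw [← h0]; exact hGmono zero_lt_one
  · apply hGmono.injective; rw [he, h0]
  · apply hGmono.injective; rw [he]
  · have := (hG (e.symm t)).of_local_left_inverse (f := G) (g := e.symm) (a := t)
      e.symm.continuous.continuousAt (inv_ne_zero (hpos _).ne') (Eventually.of_forall he)
    simpa using this

/-- The boundary profile can be replaced by one whose energy is arbitrarily close to the surface
tension. -/
theorem exists_almost_optimal_profile {W : ℝ → ℝ} {p : ℝ} (hW : IsDoubleWell W) (hp : 1 < p)
    {δ : ℝ} (hδ : 0 < δ) : ∃ (T : ℝ) (v : ℝ → ℝ), 0 < T ∧ IsTransition T v ∧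
      ∫ t in (-T)..T, (W (v t) + |deriv v t| ^ p) ≤ surfaceTension W p + δ := by
  have hp0 : 0 < p := by linarith
  have hp1 : 0 < p - 1 := by linarith
  have hq : 0 ≤ (p - 1) / p := by positivity
  set Wc : ℝ → ℝ := fun t => W (max 0 (min t 1))
  have hWcc : Continuous Wc := hW.continuous.comp (by fun_prop)
  have hWc0 : ∀ t, 0 ≤ Wc t := fun t => hW.nonneg _
  obtain ⟨M, hM0, hM⟩ := hW.exists_bound
  have hWcM : ∀ t, Wc t ≤ M := fun t => hM _ (clamp_mem_Icc t)
  -- The potential is made positive by a small constant `η`.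
  obtain ⟨η, hη, hηδ⟩ : ∃ η > 0, factor p * ∫ t in (0 : ℝ)..1, (Wc t + η) ^ ((p - 1) / p) <
      surfaceTension W p + δ := by
    have hcont : Continuous fun η : ℝ =>
        factor p * ∫ t in (0 : ℝ)..1, (Wc t + η) ^ ((p - 1) / p) := by
      refine continuous_const.mul
        (intervalIntegral.continuous_parametric_intervalIntegral_of_continuous' ?_ 0 1)
      exact ((hWcc.comp continuous_snd).add continuous_fst).rpow_const fun t => Or.inr hq
    have h0 : factor p * ∫ t in (0 : ℝ)..1, (Wc t + 0) ^ ((p - 1) / p) = surfaceTension W p := by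
      rw [← factor_mul_integral_tensionDensity]
      simp only [add_zero]
      rfl
    have hev : ∀ᶠ η in 𝓝 (0 : ℝ), factor p * ∫ t in (0 : ℝ)..1, (Wc t + η) ^ ((p - 1) / p) <
        surfaceTension W p + δ :=
      hcont.continuousAt.eventually_lt_const (by simp only [h0]; linarith)
    obtain ⟨η, hη, hη'⟩ := ((hev.filter_mono nhdsWithin_le_nhds).and
      (self_mem_nhdsWithin (s := Set.Ioi (0 : ℝ)))).exists
    exact ⟨η, hη', hη⟩
  set h : ℝ → ℝ := fun s => ((Wc s + η) / (p - 1)) ^ (1 / p)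
  have hhc : Continuous h :=
    ((hWcc.add continuous_const).div_const _).rpow_const fun t => Or.inr (by positivity)
  set b := ((M + η) / (p - 1)) ^ (1 / p)
  have hb0 : 0 ≤ b := by positivity
  have hab : ∀ s, (η / (p - 1)) ^ (1 / p) ≤ h s ∧ h s ≤ b := fun s => by
    have := hWc0 s
    have := hWcM s
    constructor
    · apply Real.rpow_le_rpow (by positivity) _ (by positivity)
      gcongr; linarith
    · apply Real.rpow_le_rpow (by have := hWc0 s; positivity) _ (by positivity)
      gcongr
  have hhpos : ∀ s, 0 < h s := fun s => lt_of_lt_of_le (by positivity) (hab s).1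
  obtain ⟨g, L, hL, hg0, hgL, hg⟩ := exists_solution_autonomous hhc (by positivity) hab
  have hgc : Continuous g := continuous_iff_continuousAt.2 fun s => (hg s).continuousAt
  have hgmono : StrictMono g := strictMono_of_deriv_pos fun s => by
    rw [(hg s).deriv]; exact hhpos _
  -- The transition, stopped at the wells, is Lipschitz.
  set v₀ : ℝ → ℝ := fun t => max 0 (min (g t) 1)
  have hv₀c : Continuous v₀ := by fun_prop
  have hv₀0 : ∀ t ≤ 0, v₀ t = 0 := fun t ht => by
    have : g t ≤ 0 := hg0 ▸ hgmono.monotone ht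
    simp only [v₀]
    rw [max_eq_left]; exact (min_le_left _ _).trans this
  have hv₀1 : ∀ t, L ≤ t → v₀ t = 1 := fun t ht => by
    have : 1 ≤ g t := hgL ▸ hgmono.monotone ht
    simp only [v₀]
    rw [min_eq_right this, max_eq_right zero_le_one]
  have hv₀g : ∀ t ∈ Set.Icc 0 L, v₀ t = g t := fun t ht =>
    clamp_of_mem_Icc ⟨hg0 ▸ hgmono.monotone ht.1, hgL ▸ hgmono.monotone ht.2⟩
  have hv₀lip : ∀ s t, s ≤ t → |v₀ t - v₀ s| ≤ b * (t - s) := by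
    intro s t hst
    have h1 : |g t - g s| ≤ b * (t - s) := by
      rw [abs_of_nonneg (sub_nonneg.2 (hgmono.monotone hst))]
      exact image_sub_le_mul_sub_of_deriv_le (f := g) (fun x => (hg x).differentiableAt)
        (fun x => by rw [(hg x).deriv]; exact (hab _).2) hst
    refine le_trans ?_ h1
    refine (abs_max_sub_max_le_max _ _ _ _).trans ?_
    rw [sub_self, abs_zero, max_eq_right (abs_nonneg _)]
    refine (abs_min_sub_min_le_max _ _ _ _).trans ?_
    rw [sub_self, abs_zero, max_eq_left (abs_nonneg _)]
  set D : ℝ → ℝ := (Set.Ioo 0 L).indicator fun t => h (g t)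
  have hv₀d : ∀ t, t ≠ 0 → t ≠ L → HasDerivAt v₀ (D t) t := by
    intro t ht0 htL
    by_cases ht : t ∈ Set.Ioo 0 L
    · have : v₀ =ᶠ[𝓝 t] g := by
        filter_upwards [isOpen_Ioo.mem_nhds ht] with s hs using hv₀g s ⟨hs.1.le, hs.2.le⟩
      simp only [D, Set.indicator_of_mem ht]
      exact (hg t).congr_of_eventuallyEq this
    · simp only [D, Set.indicator_of_notMem ht]
      rw [Set.mem_Ioo, not_and_or, not_lt, not_lt] at ht
      rcases ht with ht | ht
      · have : v₀ =ᶠ[𝓝 t] fun _ => 0 := by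
          filter_upwards [gt_mem_nhds (lt_of_le_of_ne ht ht0)] with s hs using hv₀0 s hs.le
        exact (hasDerivAt_const t (0 : ℝ)).congr_of_eventuallyEq this
      · have : v₀ =ᶠ[𝓝 t] fun _ => 1 := by
          filter_upwards [lt_mem_nhds (lt_of_le_of_ne ht htL.symm)] with s hs using hv₀1 s hs.le
        exact (hasDerivAt_const t (1 : ℝ)).congr_of_eventuallyEq this
  -- Averages over short intervals turn it into a continuously differentiable profile.
  set V : ℝ → ℝ := fun t => ∫ s in (0 : ℝ)..t, v₀ s
  have hV : ∀ t, HasDerivAt V (v₀ t) t := fun t => (hv₀c.integral_hasStrictDerivAt 0 t).hasDerivAt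
  set m : ℝ → ℝ → ℝ := fun d t => d⁻¹ * (V (t + d) - V t)
  have hm : ∀ d t, HasDerivAt (m d) (d⁻¹ * (v₀ (t + d) - v₀ t)) t := fun d t =>
    (((hV (t + d)).comp_add_const t d).sub (hV t)).const_mul _
  have hmd : ∀ d, deriv (m d) = fun t => d⁻¹ * (v₀ (t + d) - v₀ t) := fun d =>
    funext fun t => (hm d t).deriv
  have hVsub : ∀ s t, V t - V s = ∫ r in s..t, v₀ r := fun s t =>
    intervalIntegral.integral_interval_sub_left (hv₀c.intervalIntegrable _ _)
      (hv₀c.intervalIntegrable _ _)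
  have hmC : ∀ d, Continuous (m d) := fun d =>
    continuous_iff_continuousAt.2 fun t => (hm d t).continuousAt
  have hmdC : ∀ d, Continuous (deriv (m d)) := fun d => by rw [hmd]; fun_prop
  set T := L + 1
  have hT : 0 < T := by positivity
  have hmt : ∀ d ∈ Set.Ioc (0 : ℝ) 1, IsTransition T (m d) := by
    intro d ⟨hd0, hd1⟩
    have hle : ∀ t, t ≤ t + d := fun t => by linarith
    refine ⟨?_, fun t => ⟨?_, ?_⟩, fun t ht => ?_, fun t ht => ?_⟩
    · rw [contDiff_one_iff_deriv]
      exact ⟨fun t => (hm d t).differentiableAt, hmdC d⟩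
    · refine mul_nonneg (inv_nonneg.2 hd0.le) ?_
      rw [hVsub]
      exact intervalIntegral.integral_nonneg (hle t) fun r _ => le_max_left _ _
    · simp only [m]
      rw [hVsub, inv_mul_le_iff₀ hd0]
      have := intervalIntegral.integral_mono_on (hle t) (hv₀c.intervalIntegrable _ _)
        (continuous_const.intervalIntegrable (μ := volume) t (t + d)) (g := fun _ => (1 : ℝ))
        fun r _ => (clamp_mem_Icc (g r)).2
      simpa using this
    · simp only [m]
      rw [hVsub, intervalIntegral.integral_congr (g := fun _ => (0 : ℝ)) fun r hr => ?_]
      · simp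
      · rw [Set.uIcc_of_le (hle t)] at hr
        exact hv₀0 r (by linarith [hr.2])
    · simp only [m]
      rw [hVsub, intervalIntegral.integral_congr (g := fun _ => (1 : ℝ)) fun r hr => ?_]
      · simp [hd0.ne']
      · rw [Set.uIcc_of_le (hle t)] at hr
        exact hv₀1 r (by linarith [hr.1])
  have hev : ∀ᶠ d in 𝓝[>] (0 : ℝ), d ∈ Set.Ioc (0 : ℝ) 1 :=
    Ioc_mem_nhdsGT zero_lt_one
  have hlim : Tendsto (fun d => ∫ t in (-T)..T, (W (m d t) + |deriv (m d) t| ^ p)) (𝓝[>] 0)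
      (𝓝 (∫ t in (-T)..T, (W (v₀ t) + |D t| ^ p))) := by
    refine intervalIntegral.tendsto_integral_filter_of_dominated_convergence (fun _ => M + b ^ p)
      (Eventually.of_forall fun d => ?_) ?_ intervalIntegrable_const ?_
    · have h2 : Continuous fun t => |deriv (m d) t| ^ p :=
        (hmdC d).abs.rpow_const fun t => Or.inr hp0.le
      exact ((hW.continuous.comp (hmC d)).add h2).aestronglyMeasurable
    · filter_upwards [hev] with d hd
      refine Eventually.of_forall fun t _ => ?_
      have h1 : |deriv (m d) t| ≤ b := by
        rw [hmd, abs_mul, abs_inv, abs_of_pos hd.1, inv_mul_le_iff₀ hd.1]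
        have := hv₀lip t (t + d) (by linarith [hd.1])
        rw [add_sub_cancel_left] at this
        linarith
      have h2 : 0 ≤ W (m d t) + |deriv (m d) t| ^ p :=
        add_nonneg (hW.nonneg _) (Real.rpow_nonneg (abs_nonneg _) _)
      rw [Real.norm_eq_abs, abs_of_nonneg h2]
      gcongr
      exact hM _ ((hmt d hd).mem_Icc t)
    · have hne : ∀ᵐ t : ℝ, t ≠ 0 ∧ t ≠ L := by
        have h1 : ∀ᵐ t : ℝ, t ≠ 0 := (Set.countable_singleton (0 : ℝ)).ae_notMem volume
        have h2 : ∀ᵐ t : ℝ, t ≠ L := (Set.countable_singleton L).ae_notMem volume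
        exact h1.and h2
      filter_upwards [hne] with t ht _
      have h1 : Tendsto (fun d => m d t) (𝓝[>] 0) (𝓝 (v₀ t)) := by
        simpa [m] using (hV t).tendsto_slope_zero_right
      have h2 : Tendsto (fun d => deriv (m d) t) (𝓝[>] 0) (𝓝 (D t)) := by
        simpa [hmd] using (hv₀d t ht.1 ht.2).tendsto_slope_zero_right
      exact ((hW.continuous.tendsto _).comp h1).add (h2.abs.rpow_const (Or.inr hp0.le))
  -- Along the solution of the equation, Young's inequality is an equality.
  have hval : ∫ t in (-T)..T, (W (v₀ t) + |D t| ^ p) ≤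
      factor p * ∫ t in (0 : ℝ)..1, (Wc t + η) ^ ((p - 1) / p) := by
    set F : ℝ → ℝ := fun s => factor p * (Wc s + η) ^ ((p - 1) / p)
    have hFc : Continuous F :=
      continuous_const.mul ((hWcc.add continuous_const).rpow_const fun t => Or.inr hq)
    have hF0 : ∀ s, 0 ≤ F s := fun s =>
      mul_nonneg (factor_pos hp).le (Real.rpow_nonneg (by have := hWc0 s; positivity) _)
    have hderiv : ∀ t, HasDerivAt (fun t => ∫ s in (0 : ℝ)..g t, F s) (F (g t) * h (g t)) t :=
      fun t => ((hFc.integral_hasStrictDerivAt 0 (g t)).hasDerivAt).comp t (hg t)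
    have hFg : Continuous fun t => F (g t) * h (g t) := (hFc.comp hgc).mul (hhc.comp hgc)
    have hpt : ∀ t, W (v₀ t) + |D t| ^ p ≤
        (Set.Icc 0 L).indicator (fun t => F (g t) * h (g t)) t := by
      intro t
      by_cases ht : t ∈ Set.Icc 0 L
      · rw [Set.indicator_of_mem ht]
        have hDle : |D t| ≤ h (g t) := by
          by_cases ht' : t ∈ Set.Ioo 0 L
          · simp only [D, Set.indicator_of_mem ht', abs_of_pos (hhpos _), le_refl]
          · simp only [D, Set.indicator_of_notMem ht', abs_zero, (hhpos _).le]
        have hWle : W (v₀ t) ≤ Wc (g t) + η := by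
          change Wc (g t) ≤ _; linarith
        have hyoung : Wc (g t) + η + h (g t) ^ p = F (g t) * h (g t) :=
          factor_mul_eq hp (by have := hWc0 (g t); positivity)
        rw [← hyoung]
        gcongr
      · have hD : D t = 0 := Set.indicator_of_notMem (fun h' => ht ⟨h'.1.le, h'.2.le⟩) _
        have hv : v₀ t = 0 ∨ v₀ t = 1 := by
          rw [Set.mem_Icc, not_and_or, not_le, not_le] at ht
          rcases ht with ht | ht
          · exact Or.inl (hv₀0 t ht.le)
          · exact Or.inr (hv₀1 t ht.le)
        rw [Set.indicator_of_notMem ht, hD, (hW.eq_zero_iff _).2 hv, abs_zero,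
          Real.zero_rpow hp0.ne', add_zero]
    have hind : IntegrableOn ((Set.Icc 0 L).indicator fun t => F (g t) * h (g t))
        (Set.Ioc (-T) T) :=
      ((integrable_indicator_iff measurableSet_Icc).2
        (hFg.continuousOn.integrableOn_compact isCompact_Icc)).integrableOn
    have hleT : -T ≤ T := by linarith
    rw [intervalIntegral.integral_of_le hleT]
    calc ∫ t in Set.Ioc (-T) T, (W (v₀ t) + |D t| ^ p)
        ≤ ∫ t in Set.Ioc (-T) T, (Set.Icc 0 L).indicator (fun t => F (g t) * h (g t)) t := by
          refine integral_mono_of_nonneg (Eventually.of_forall fun t => ?_) hind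
            (Eventually.of_forall hpt)
          exact add_nonneg (hW.nonneg _) (Real.rpow_nonneg (abs_nonneg _) _)
      _ = ∫ t in Set.Icc 0 L, F (g t) * h (g t) := by
          rw [setIntegral_indicator measurableSet_Icc, Set.inter_eq_right.2]
          exact fun t ht => ⟨by linarith [ht.1], by linarith [ht.2]⟩
      _ = ∫ t in (0 : ℝ)..L, F (g t) * h (g t) := by
          rw [integral_Icc_eq_integral_Ioc, intervalIntegral.integral_of_le hL.le]
      _ = ∫ s in (0 : ℝ)..1, F s := by
          rw [intervalIntegral.integral_eq_sub_of_hasDerivAt (fun t _ => hderiv t)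
            (hFg.intervalIntegrable _ _), hg0, hgL, intervalIntegral.integral_same, sub_zero]
      _ = _ := by simp only [F, intervalIntegral.integral_const_mul]
  have hev2 := hlim.eventually_lt_const (hval.trans_lt hηδ)
  obtain ⟨d, hd, hd'⟩ := (hev.and hev2).exists
  exact ⟨T, m d, hT, hmt d hd, hd'.le⟩

/-! ### The upper bound -/

/-- A one-dimensional profile, rescaled by `ε`, has in a cube at most its one-dimensional energy
times the area of the cross-section. -/
theorem lintegral_profile_le (hn : 0 < n) (hR : IsRotationFamily n R) (ν : S n) {ρ ε T I : ℝ}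
    (hρ : 0 < ρ) (hε : 0 < ε) (hT : 0 < T) (hTε : T * ε < ρ / 2) (x : E n) {v : ℝ → ℝ}
    (hv : IsTransition T v) (hW : IsDoubleWell W) (hp : 0 < p) (hc₂ : 0 ≤ c₂)
    (hI : ∫ t in (-T)..T, (W (v t) + |deriv v t| ^ p) ≤ I) {f : E n → ℝ → E n → ℝ}
    (hf : IsIntegrand W p c₁ c₂ f) :
    ENNReal.ofReal (1 / ε) * ∫⁻ y in cube R ν ρ x, ENNReal.ofReal
        (f y (boundaryDatum v ε x ν y) (ε • gradient (boundaryDatum v ε x ν) y)) ≤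
      ENNReal.ofReal (c₂ * I * ρ ^ (n - 1)) := by
  set H : ℝ → ℝ := fun t => W (v t) + |deriv v t| ^ p
  have hdv : Continuous (deriv v) := hv.contDiff.continuous_deriv le_rfl
  have hHc : Continuous H :=
    (hW.continuous.comp hv.contDiff.continuous).add (hdv.abs.rpow_const fun t => Or.inr hp.le)
  have hH0 : ∀ t, 0 ≤ H t := fun t =>
    add_nonneg (hW.nonneg _) (Real.rpow_nonneg (abs_nonneg _) _)
  have hHT : ∀ t, T < |t| → H t = 0 := fun t ht => by
    have hvt : v t = 0 ∨ v t = 1 := by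
      rcases lt_abs.1 ht with h | h
      · exact Or.inr (hv.eq_one t h)
      · exact Or.inl (hv.eq_zero t (by linarith))
    simp only [H]
    rw [(hW.eq_zero_iff _).2 hvt, hv.deriv_eq_zero ht, abs_zero, Real.zero_rpow hp.ne', add_zero]
  set F : ℝ → ℝ := fun t => c₂ * H (1 / ε * t)
  have hFc : Continuous F := by fun_prop
  have hF0 : ∀ t, 0 ≤ F t := fun t => mul_nonneg hc₂ (hH0 _)
  have hpt : ∀ y, f y (boundaryDatum v ε x ν y) (ε • gradient (boundaryDatum v ε x ν) y) ≤
      F (inner ℝ (y - x) (ν : E n)) := fun y => by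
    refine (hf.upper _ _ _).trans (le_of_eq ?_)
    rw [norm_smul, Real.norm_eq_abs, abs_of_pos hε, norm_gradient,
      norm_fderiv_boundaryDatum hv.contDiff hε]
    rfl
  have hm : Measurable fun y : E n => (inner ℝ (y - x) (ν : E n) : ℝ) := by fun_prop
  set a := ρ / 2
  have ha : -a ≤ a := by simp only [a]; linarith
  have hint : ∫⁻ t in Set.Ioo (-a) a, ENNReal.ofReal (F t) ≤ ENNReal.ofReal (c₂ * (ε * I)) := by
    have hFi : IntegrableOn F (Set.Ioo (-a) a) :=
      (hFc.continuousOn.integrableOn_compact isCompact_Icc).mono_set Set.Ioo_subset_Icc_self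
    rw [← ofReal_integral_eq_lintegral_ofReal hFi (Eventually.of_forall hF0)]
    refine ENNReal.ofReal_le_ofReal ?_
    rw [← integral_Ioc_eq_integral_Ioo, ← intervalIntegral.integral_of_le ha]
    simp only [F]
    rw [intervalIntegral.integral_const_mul,
      intervalIntegral.integral_comp_mul_left H (by positivity : (1 / ε) ≠ 0)]
    simp only [one_div, inv_inv, smul_eq_mul]
    gcongr
    refine le_trans (le_of_eq ?_) hI
    have hTa : T < ε⁻¹ * a := by rw [lt_inv_mul_iff₀ hε]; linarith
    rw [intervalIntegral.integral_of_le (by linarith),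
      intervalIntegral.integral_of_le (by linarith), ← integral_Icc_eq_integral_Ioc,
      ← integral_Icc_eq_integral_Ioc]
    refine setIntegral_eq_of_subset_of_forall_sdiff_eq_zero measurableSet_Icc
      (Set.Icc_subset_Icc (by linarith) (by linarith)) fun t ht => hHT t ?_
    by_contra hle
    exact ht.2 (abs_le.1 (not_lt.1 hle))
  calc _ ≤ ENNReal.ofReal (1 / ε) *
        ∫⁻ y in cube R ν ρ x, ENNReal.ofReal (F (inner ℝ (y - x) (ν : E n))) := by
        gcongr; exact hpt _
    _ = ENNReal.ofReal (1 / ε) * (ENNReal.ofReal (ρ ^ (n - 1)) *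
          ∫⁻ t in Set.Ioo (-a) a, ENNReal.ofReal (F t)) := by
        rw [← lintegral_map (hFc.measurable.ennreal_ofReal) hm,
          map_inner_restrict_cube hn hR ν hρ x, lintegral_smul_measure, smul_eq_mul]
    _ ≤ ENNReal.ofReal (1 / ε) * (ENNReal.ofReal (ρ ^ (n - 1)) *
          ENNReal.ofReal (c₂ * (ε * I))) := by gcongr
    _ = _ := by
        rw [← ENNReal.ofReal_mul (by positivity), ← ENNReal.ofReal_mul (by positivity)]
        congr 1; field_simp

theorem hasSobolevGradient_zero (A : Set (E n)) :
    HasSobolevGradient p A (fun _ => 0) (fun _ => 0) where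
  memLp := MemLp.zero
  memLp_grad := MemLp.zero
  weak φ _ _ _ i := by simp

/-- For small `ε` the minimal energy exceeds the optimal one-dimensional energy by an arbitrarily
small fraction of the area: an almost optimal profile is used in most of the cube and glued to
the boundary datum near the lateral boundary. -/
theorem exists_forall_minEnergy_le (hn : 0 < n) (hR : IsRotationFamily n R) (ν : S n) {ρ : ℝ}
    (hρ : 0 < ρ) (x : E n) {w : ℝ → ℝ} (hw : IsTransition 1 w) (hW : IsDoubleWell W) (hp : 1 < p)
    (hc₂ : 0 ≤ c₂) {δ : ℝ} (hδ : 0 < δ) :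
    ∃ ε₀ > 0, ∀ ε, 0 < ε → ε < ε₀ → ∀ f : E n → ℝ → E n → ℝ, IsIntegrand W p c₁ c₂ f →
      minEnergy f ε p (boundaryDatum w ε x ν) (cube R ν ρ x) ≤
        ENNReal.ofReal ((c₂ * (surfaceTension W p + δ) + δ) * ρ ^ (n - 1)) := by
  obtain ⟨T, v, hT, hv, hI⟩ := exists_almost_optimal_profile hW hp hδ
  obtain ⟨M, hM0, hM⟩ := hW.exists_bound
  obtain ⟨L₁, hL₁0, hL₁⟩ := hv.exists_bound_deriv
  obtain ⟨L₂, hL₂0, hL₂⟩ := hw.exists_bound_deriv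
  have hp0 : 0 < p := by linarith
  set T' := max T 1
  have hT' : 0 < T' := hT.trans_le (le_max_left _ _)
  set L := max L₁ L₂
  have hL0 : 0 ≤ L := hL₁0.trans (le_max_left _ _)
  set C := 2 * T' * (c₂ * (M + (2 * L + 1) ^ p))
  -- The lateral layer is chosen so thin that its energy is at most `δ` times the area.
  obtain ⟨r, hr, hrρ, hrδ⟩ : ∃ r, 0 < r ∧ r < ρ ∧
      C * (ρ ^ (n - 1) - r ^ (n - 1)) ≤ δ * ρ ^ (n - 1) := by
    have hc : Continuous fun r : ℝ => C * (ρ ^ (n - 1) - r ^ (n - 1)) := by fun_prop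
    have h1 : ∀ᶠ r in 𝓝[<] ρ, C * (ρ ^ (n - 1) - r ^ (n - 1)) < δ * ρ ^ (n - 1) :=
      (hc.continuousAt.eventually_lt_const
        (by simp only [sub_self, mul_zero]; positivity)).filter_mono nhdsWithin_le_nhds
    have h2 : ∀ᶠ r in 𝓝[<] ρ, r ∈ Set.Ioo 0 ρ := Ioo_mem_nhdsLT hρ
    obtain ⟨r, hr1, hr2⟩ := (h1.and h2).exists
    exact ⟨r, hr2.1, hr2.2, hr1.le⟩
  obtain ⟨s, hs, hs'⟩ := exists_between (show r / 2 < ρ / 2 by linarith)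
  obtain ⟨χ, hχ, hχ01, hχ1, hχ0, -, hχc⟩ := exists_cube_cutoff hR ν hs x
  obtain ⟨B, hB0, hB⟩ : ∃ B, 0 ≤ B ∧ ∀ y, ‖fderiv ℝ χ y‖ ≤ B := by
    obtain ⟨B, hB⟩ := (hχ.continuous_fderiv (by simp)).norm.bounded_above_of_compact_support
      (hχc.fderiv ℝ).norm
    have hB' : ∀ y, ‖fderiv ℝ χ y‖ ≤ B := fun y => by simpa using hB y
    exact ⟨B, (norm_nonneg _).trans (hB' 0), hB'⟩
  refine ⟨min (r / (2 * T')) (1 / (B + 1)), by positivity, fun ε hε hεlt f hf => ?_⟩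
  have hε1 : T' * ε < r / 2 := by
    have := (lt_min_iff.1 hεlt).1
    rw [lt_div_iff₀ (by positivity)] at this
    linarith
  have hε2 : ε * B ≤ 1 := by
    have := (lt_min_iff.1 hεlt).2
    rw [lt_div_iff₀ (by positivity)] at this
    nlinarith
  have hTε : T * ε < r / 2 := by
    have : T * ε ≤ T' * ε := by gcongr; exact le_max_left _ _
    linarith
  have hKeq : cube R ν r x = {y | cubeNorm (R ν) (y - x) < r / 2} := cube_eq hR ν hr x
  have hcmp := minEnergy_le_of_interpolate hR ν hρ x hp.le hf ε (K := cube R ν r x)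
    (z := fun _ => 0) (h := fun _ => 0)
    (contDiff_boundaryDatum hv.contDiff ε x ν) (fun y => hv.mem_Icc _)
    (contDiff_boundaryDatum hw.contDiff ε x ν) (fun y => hw.mem_Icc _) hχ hχ01 hs'
    (isOpen_cube hR ν hr x)
    (fun y hy => by rw [hKeq, Set.mem_ofPred_eq] at hy; linarith)
    (fun y hy => by rw [hKeq, Set.mem_ofPred_eq] at hy; exact hχ1 y hy.le)
    hχ0 (hasSobolevGradient_zero _) (fun _ _ => rfl) (fun _ _ => rfl)
    (Eventually.of_forall fun y => by rw [add_zero]; exact hv.mem_Icc _)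
  refine hcmp.trans ?_
  simp only [add_zero]
  rw [mul_add]
  have h1 := lintegral_profile_le hn hR ν hr hε hT hTε x hv hW hp0 hc₂ hI hf
  have h2 := layer_energy_le hn hR ν hr hrρ.le x hW hp0 hc₂ hε hM hχ hχ01 hT'
    (hv.mono (le_max_left _ _)) (hw.mono (le_max_right _ _))
    (fun t => (hL₁ t).trans (le_max_left _ L₂)) (fun t => (hL₂ t).trans (le_max_right L₁ _))
    (fun y => by
      have hle : |boundaryDatum v ε x ν y - boundaryDatum w ε x ν y| ≤ 1 := by
        have a1 : boundaryDatum v ε x ν y ∈ Set.Icc (0 : ℝ) 1 := hv.mem_Icc _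
        have a2 : boundaryDatum w ε x ν y ∈ Set.Icc (0 : ℝ) 1 := hw.mem_Icc _
        rw [abs_le]; constructor <;> linarith [a1.1, a1.2, a2.1, a2.2]
      calc _ ≤ ε * (1 * B) := by gcongr; exact hB y
        _ ≤ 1 := by linarith) hε1
  have hST : 0 ≤ surfaceTension W p + δ := by
    refine le_trans (intervalIntegral.integral_nonneg (by linarith) fun t _ => ?_) hI
    exact add_nonneg (hW.nonneg _) (Real.rpow_nonneg (abs_nonneg _) _)
  have hrn : r ^ (n - 1) ≤ ρ ^ (n - 1) := by gcongr
  refine (add_le_add h1 h2).trans ?_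
  have hC0 : 0 ≤ C * (ρ ^ (n - 1) - r ^ (n - 1)) :=
    mul_nonneg (by positivity) (sub_nonneg.2 hrn)
  rw [← ENNReal.ofReal_add (by positivity) hC0]
  refine ENNReal.ofReal_le_ofReal ?_
  have : c₂ * (surfaceTension W p + δ) * r ^ (n - 1) ≤
      c₂ * (surfaceTension W p + δ) * ρ ^ (n - 1) := by gcongr
  linarith

/-! ### Dependence of the cell minima on the cube -/

/-- Enlarging the cube increases the minimal energy at most by a constant times the increase of the
area of its cross-section. -/
theorem exists_minEnergy_cube_le (hn : 0 < n) (hR : IsRotationFamily n R) (ν : S n) (x : E n)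
    {w : ℝ → ℝ} (hw : IsTransition 1 w) (hW : IsDoubleWell W) (hp : 1 < p) (hc₂ : 0 ≤ c₂) :
    ∃ C, ∀ r ρ ε : ℝ, 0 < r → r < ρ → 0 < ε → ε < r / 2 →
      ∀ f : E n → ℝ → E n → ℝ, IsIntegrand W p c₁ c₂ f →
      minEnergy f ε p (boundaryDatum w ε x ν) (cube R ν ρ x) ≤
        minEnergy f ε p (boundaryDatum w ε x ν) (cube R ν r x) +
          ENNReal.ofReal (C * (ρ ^ (n - 1) - r ^ (n - 1))) := by
  obtain ⟨M, hM0, hM⟩ := hW.exists_bound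
  obtain ⟨L, hL0, hL⟩ := hw.exists_bound_deriv
  refine ⟨2 * 1 * (c₂ * (M + (2 * L + 1) ^ p)),
    fun r ρ ε hr hrρ hε hεr f hf => ?_⟩
  have hρ := hr.trans hrρ
  rw [← tsub_le_iff_right]
  refine le_iInf₂ fun u hu => ?_
  rw [tsub_le_iff_right]
  set v := boundaryDatum w ε x ν
  have hv : ContDiff ℝ 1 v := contDiff_boundaryDatum hw.contDiff ε x ν
  have hv01 : ∀ y, v y ∈ Set.Icc (0 : ℝ) 1 := fun y => hw.mem_Icc _
  obtain ⟨r', z, h, hr', hr'r, hz, hz0, hh0, huz, hsob⟩ :=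
    exists_decomposition_of_mem_admissible hR ν hp.le hr x hv hu
  have hA : IsOpen (cube R ν r x) := isOpen_cube hR ν hr x
  rw [energy_eq f ε hp.le hA hsob hu.1.2]
  obtain ⟨s, hs, hs'⟩ := exists_between (show r / 2 < ρ / 2 by linarith)
  obtain ⟨χ, hχ, hχ01, hχ1, hχ0, -, -⟩ := exists_cube_cutoff hR ν hs x
  have hKeq : cube R ν r x = {y | cubeNorm (R ν) (y - x) < r / 2} := cube_eq hR ν hr x
  have hsub : cube R ν r' x ⊆ cube R ν r x := cube_subset_cube hR ν hr' hr'r.le x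
  have hcmp := minEnergy_le_of_interpolate hR ν hρ x hp.le hf ε (K := cube R ν r x)
    hv hv01 hv hv01 hχ hχ01 hs' hA
    (fun y hy => by rw [hKeq, Set.mem_ofPred_eq] at hy; linarith)
    (fun y hy => by rw [hKeq, Set.mem_ofPred_eq] at hy; exact hχ1 y hy.le)
    hχ0 hz (fun y hy => hz0 y fun h => hy (hsub h)) (fun y hy => hh0 y fun h => hy (hsub h))
    (by filter_upwards [huz, hu.1.2] with y hy hy'; rwa [← hy])
  refine hcmp.trans ?_
  rw [mul_add]
  refine add_le_add (le_of_eq ?_) ?_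
  · congr 1
    refine lintegral_congr_ae ?_
    filter_upwards [huz] with y hy
    rw [hy]
  · exact layer_energy_le hn hR ν hr hrρ.le x hW (by linarith) hc₂ hε hM hχ hχ01 one_pos hw hw hL hL
      (fun y => by simp) (by linarith)

/-- For fixed `ε` and fixed size of the cube, the minimal energy is upper semicontinuous in the
centre and in the direction, as long as the orientation of the cube depends continuously on the
direction: a competitor for one cube is glued to the datum of a nearby cube in a thin layer. -/
theorem upperSemicontinuous_minEnergy (hR : IsRotationFamily n R) {H : Set (S n)}
    (hH : ContinuousOn R H) {ρ ε : ℝ} (hρ : 0 < ρ) (hε : 0 < ε) {w : ℝ → ℝ}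
    (hw : IsTransition 1 w) (hW : IsDoubleWell W) (hp : 1 < p) (hc₂ : 0 ≤ c₂)
    {f : E n → ℝ → E n → ℝ} (hf : IsIntegrand W p c₁ c₂ f) :
    UpperSemicontinuous fun q : E n × H =>
      minEnergy f ε p (boundaryDatum w ε q.1 q.2) (cube R q.2 ρ q.1) := by
  intro q₀ b hb
  obtain ⟨M, hM0, hM⟩ := hW.exists_bound
  obtain ⟨L, hL0, hL⟩ := hw.exists_bound_deriv
  obtain ⟨x₀, ν₀⟩ := q₀
  simp only [minEnergy] at hb
  obtain ⟨u, hu'⟩ := iInf_lt_iff.1 hb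
  obtain ⟨hu, hub⟩ := iInf_lt_iff.1 hu'
  set v₀ := boundaryDatum w ε x₀ (ν₀ : S n)
  have hv₀ : ContDiff ℝ 1 v₀ := contDiff_boundaryDatum hw.contDiff ε x₀ _
  obtain ⟨r, z, h, hr, hrρ, hz, hz0, hh0, huz, hsob⟩ :=
    exists_decomposition_of_mem_admissible hR (ν₀ : S n) hp.le hρ x₀ hv₀ hu
  have hA : IsOpen (cube R (ν₀ : S n) ρ x₀) := isOpen_cube hR _ hρ x₀
  rw [energy_eq f ε hp.le hA hsob hu.1.2] at hub
  set e₀ := ENNReal.ofReal (1 / ε) * ∫⁻ y in cube R (ν₀ : S n) ρ x₀,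
    ENNReal.ofReal (f y (u y) (ε • (gradient v₀ y + h y)))
  set C := c₂ * (M + (2 * L + 1) ^ p)
  have hC : 0 ≤ C := by positivity
  -- The layer in which the datum is changed is so thin that its energy fits into the gap.
  obtain ⟨r', hr', hr'ρ, hr'b⟩ : ∃ r', r < r' ∧ r' < ρ ∧
      e₀ + ENNReal.ofReal (1 / ε * (C * (ρ ^ n - r' ^ n))) < b := by
    have hc : Continuous fun r' : ℝ => e₀ + ENNReal.ofReal (1 / ε * (C * (ρ ^ n - r' ^ n))) :=
      continuous_const.add (ENNReal.continuous_ofReal.comp (by fun_prop))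
    have h1 : ∀ᶠ r' in 𝓝[<] ρ, e₀ + ENNReal.ofReal (1 / ε * (C * (ρ ^ n - r' ^ n))) < b :=
      (hc.continuousAt.eventually_lt_const (by simpa using hub)).filter_mono nhdsWithin_le_nhds
    have h2 : ∀ᶠ r' in 𝓝[<] ρ, r' ∈ Set.Ioo r ρ := Ioo_mem_nhdsLT hrρ
    obtain ⟨r', hr1, hr2⟩ := (h1.and h2).exists
    exact ⟨r', hr2.1, hr2.2, hr1⟩
  have hr'0 : 0 < r' := hr.trans hr'
  obtain ⟨s, hs, hs'⟩ := exists_between (show r' / 2 < ρ / 2 by linarith)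
  obtain ⟨s₁, hs₁, hs₁'⟩ := exists_between hs'
  obtain ⟨χ, hχ, hχ01, hχ1, hχ0, hχs, -⟩ := exists_cube_cutoff hR (ν₀ : S n) hs x₀
  set K := cube R (ν₀ : S n) r' x₀
  have hKeq : K = {y | cubeNorm (R ν₀) (y - x₀) < r' / 2} := cube_eq hR _ hr'0 x₀
  have hKo : IsOpen K := isOpen_cube hR _ hr'0 x₀
  have hKA : K ⊆ cube R (ν₀ : S n) ρ x₀ := cube_subset_cube hR _ hr'0 hr'ρ.le x₀
  have hrK : cube R (ν₀ : S n) r x₀ ⊆ K := cube_subset_cube hR _ hr hr'.le x₀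
  set Cs := {y | cubeNorm (R ν₀) (y - x₀) ≤ s}
  have hCs : IsCompact Cs := isCompact_cubeNorm_le hR _ s x₀
  have hRc : Continuous fun ν : H => R ν := continuousOn_iff_continuous_domRestrict.1 hH
  have hev1 : ∀ᶠ q : E n × H in 𝓝 (x₀, ν₀), ∀ y ∈ Cs, cubeNorm (R q.2) (y - q.1) < s₁ := by
    refine hCs.eventually_forall_of_forall_eventually
      (P := fun (q : E n × H) y => cubeNorm (R q.2) (y - q.1) < s₁) fun y hy => ?_
    have hR' : Continuous fun a : (E n × H) × E n => R a.1.2 :=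
      hRc.comp (continuous_snd.comp continuous_fst)
    have hd : Continuous fun a : (E n × H) × E n => a.2 - a.1.1 :=
      continuous_snd.sub (continuous_fst.comp continuous_fst)
    have hc : Continuous fun a : (E n × H) × E n => cubeNorm (R a.1.2) (a.2 - a.1.1) :=
      continuous_cubeNorm hR' hd
    have hy' : cubeNorm (R ν₀) (y - x₀) < s₁ := lt_of_le_of_lt hy hs₁
    exact hc.continuousAt.eventually_lt_const hy'
  have hev2 : ∀ᶠ q : E n × H in 𝓝 (x₀, ν₀), ∀ y ∈ Cs,
      ε * (|v₀ y - boundaryDatum w ε q.1 q.2 y| * ‖fderiv ℝ χ y‖) < 1 := by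
    refine hCs.eventually_forall_of_forall_eventually
      (P := fun (q : E n × H) y =>
        ε * (|v₀ y - boundaryDatum w ε q.1 q.2 y| * ‖fderiv ℝ χ y‖) < 1) fun y hy => ?_
    have hc1 : Continuous fun a : (E n × H) × E n => boundaryDatum w ε a.1.1 a.1.2 a.2 := by
      unfold boundaryDatum
      exact hw.contDiff.continuous.comp (by fun_prop)
    have hc2 : Continuous fun y => ‖fderiv ℝ χ y‖ := (hχ.continuous_fderiv (by simp)).norm
    have hc : Continuous fun a : (E n × H) × E n =>
        ε * (|v₀ a.2 - boundaryDatum w ε a.1.1 a.1.2 a.2| * ‖fderiv ℝ χ a.2‖) :=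
      continuous_const.mul ((((hv₀.continuous.comp continuous_snd).sub hc1).abs).mul
        (hc2.comp continuous_snd))
    refine hc.continuousAt.eventually_lt_const ?_
    simp [v₀]
  filter_upwards [hev1, hev2] with q hq1 hq2
  obtain ⟨x, ν⟩ := q
  simp only at hq1 hq2 ⊢
  set v := boundaryDatum w ε x (ν : S n)
  have hv : ContDiff ℝ 1 v := contDiff_boundaryDatum hw.contDiff ε x _
  have hKCs : ∀ y ∈ K, y ∈ Cs := fun y hy => by
    rw [hKeq, Set.mem_ofPred_eq] at hy
    rw [Set.mem_ofPred_eq]; linarith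
  have hcmp := minEnergy_le_of_interpolate hR (ν : S n) hρ x hp.le hf ε (K := K) (s := s₁)
    hv₀ (fun y => hw.mem_Icc _) hv (fun y => hw.mem_Icc _) hχ hχ01 hs₁' hKo
    (fun y hy => (hq1 y (hKCs y hy)).le)
    (fun y hy => by rw [hKeq, Set.mem_ofPred_eq] at hy; exact hχ1 y hy.le)
    (fun y hy => by
      by_cases hyC : y ∈ Cs
      · exact absurd (hq1 y hyC) (not_lt.2 hy)
      · rw [Set.mem_ofPred_eq, not_le] at hyC
        exact hχ0 y hyC.le)
    hz (fun y hy => hz0 y fun h => hy (hrK h)) (fun y hy => hh0 y fun h => hy (hrK h))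
    (by
      have h1 := ae_mono (Measure.restrict_mono_set volume hKA) huz
      have h2 := ae_mono (Measure.restrict_mono_set volume hKA) hu.1.2
      filter_upwards [h1, h2] with y hy hy'
      rwa [← hy])
  refine hcmp.trans_lt (lt_of_le_of_lt ?_ hr'b)
  rw [mul_add]
  refine add_le_add ?_ ?_
  · refine mul_le_mul_right (le_trans (le_of_eq ?_) (lintegral_mono_set hKA)) _
    refine lintegral_congr_ae ?_
    filter_upwards [ae_mono (Measure.restrict_mono_set volume hKA) huz] with y hy
    rw [hy]
  · have hAq : IsOpen (cube R (ν : S n) ρ x) := isOpen_cube hR _ hρ x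
    have hKAq : K ⊆ cube R (ν : S n) ρ x := fun y hy => by
      rw [cube_eq hR _ hρ, Set.mem_ofPred_eq]
      exact (hq1 y (hKCs y hy)).trans hs₁'
    have hvol : volume (cube R (ν : S n) ρ x \ K) = ENNReal.ofReal (ρ ^ n - r' ^ n) := by
      rw [measure_sdiff hKAq hKo.measurableSet.nullMeasurableSet, volume_cube hR _ hρ,
        volume_cube hR _ hr'0, ← ENNReal.ofReal_sub _ (by positivity)]
      rw [volume_cube hR _ hr'0]; exact ENNReal.ofReal_ne_top
    rw [ENNReal.ofReal_mul (by positivity), ENNReal.ofReal_mul hC, ← hvol, ← setLIntegral_const]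
    gcongr with y
    refine layer_density_le hχ hv₀ hv hε (by linarith) hc₂ hM (hχ01 y) (hw.mem_Icc _) (hw.mem_Icc _)
      (L := L) ?_ ?_ ?_
    · rw [norm_fderiv_boundaryDatum hw.contDiff hε]; exact hL _
    · rw [norm_fderiv_boundaryDatum hw.contDiff hε]; exact hL _
    · by_cases hyC : y ∈ Cs
      · exact (hq2 y hyC).le
      · have : fderiv ℝ χ y = 0 := by
          by_contra hne; exact hyC (hχs (support_fderiv_subset ℝ hne))
        simp [this]

/-! ### Measurability and conclusion -/

theorem continuous_sphere_apply (i : Fin n) : Continuous fun ν : S n => (ν : E n) i :=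
  (EuclideanSpace.proj (𝕜 := ℝ) i).continuous.comp continuous_subtype_val

theorem measurableSet_hemispherePos : MeasurableSet (hemispherePos n) := by
  have : hemispherePos n = ⋃ i : Fin n, ({ν : S n | 0 < (ν : E n) i} ∩
      ⋂ j : Fin n, ⋂ _ : i < j, {ν : S n | (ν : E n) j = 0}) := by
    ext ν; simp [hemispherePos]
  rw [this]
  exact .iUnion fun i => .inter
    (isOpen_lt continuous_const (continuous_sphere_apply i)).measurableSet
    (.iInter fun j => .iInter fun _ =>
      (isClosed_eq (continuous_sphere_apply j) continuous_const).measurableSet)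

theorem measurableSet_hemisphereNeg : MeasurableSet (hemisphereNeg n) := by
  have : hemisphereNeg n = ⋃ i : Fin n, ({ν : S n | (ν : E n) i < 0} ∩
      ⋂ j : Fin n, ⋂ _ : i < j, {ν : S n | (ν : E n) j = 0}) := by
    ext ν; simp [hemisphereNeg]
  rw [this]
  exact .iUnion fun i => .inter
    (isOpen_lt (continuous_sphere_apply i) continuous_const).measurableSet
    (.iInter fun j => .iInter fun _ =>
      (isClosed_eq (continuous_sphere_apply j) continuous_const).measurableSet)

theorem mem_hemispherePos_or_mem_hemisphereNeg (ν : S n) :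
    ν ∈ hemispherePos n ∨ ν ∈ hemisphereNeg n := by
  have hne : (Finset.univ.filter fun i : Fin n => (ν : E n) i ≠ 0).Nonempty := by
    by_contra h
    rw [Finset.not_nonempty_iff_eq_empty, Finset.filter_eq_empty_iff] at h
    have h0 : (ν : E n) = 0 := by
      ext i; simpa using h (Finset.mem_univ i)
    have h1 : ‖(ν : E n)‖ = 1 := by simp
    simp [h0] at h1
  obtain ⟨i, hi, hmax⟩ := Finset.exists_max_image _ id hne
  have hz : ∀ j : Fin n, i < j → (ν : E n) j = 0 := fun j hj => by
    by_contra hj0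
    exact absurd (hmax j (by simp [hj0])) (not_le.2 hj)
  rw [Finset.mem_filter] at hi
  rcases lt_or_gt_of_ne hi.2 with h | h
  · exact Or.inr ⟨i, h, hz⟩
  · exact Or.inl ⟨i, h, hz⟩

theorem measurable_of_prod_union_cover {X Y Z : Type*} [MeasurableSpace X] [MeasurableSpace Y]
    [MeasurableSpace Z] {F : X × Y → Z} {s t : Set Y} (hs : MeasurableSet s) (ht : MeasurableSet t)
    (hst : ∀ y, y ∈ s ∨ y ∈ t) (h₁ : Measurable fun q : X × s => F (q.1, q.2))
    (h₂ : Measurable fun q : X × t => F (q.1, q.2)) : Measurable F := by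
  have key : ∀ r : Set Y, (Measurable fun q : X × r => F (q.1, q.2)) →
      Measurable fun a : (Set.univ ×ˢ r : Set (X × Y)) => F a := by
    intro r h
    have hmem : ∀ a : (Set.univ ×ˢ r : Set (X × Y)), (a : X × Y).2 ∈ r :=
      fun a => (Set.mem_prod.1 a.2).2
    have h' : Measurable fun a : (Set.univ ×ˢ r : Set (X × Y)) =>
        (((a : X × Y).1, ⟨(a : X × Y).2, hmem a⟩) : X × r) :=
      (measurable_fst.comp measurable_subtype_coe).prodMk
        (Measurable.subtype_mk (measurable_snd.comp measurable_subtype_coe))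
    exact h.comp h'
  exact measurable_of_measurable_union_cover (Set.univ ×ˢ s) (Set.univ ×ˢ t)
    (MeasurableSet.univ.prod hs) (MeasurableSet.univ.prod ht)
    (fun z _ => (hst z.2).imp (fun h => ⟨Set.mem_univ _, h⟩) fun h => ⟨Set.mem_univ _, h⟩)
    (key s h₁) (key t h₂)

theorem measurable_minEnergy (hR : IsRotationFamily n R) {ρ ε : ℝ} (hρ : 0 < ρ) (hε : 0 < ε)
    {w : ℝ → ℝ} (hw : IsTransition 1 w) (hW : IsDoubleWell W) (hp : 1 < p) (hc₂ : 0 ≤ c₂)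
    {f : E n → ℝ → E n → ℝ} (hf : IsIntegrand W p c₁ c₂ f) :
    Measurable fun z : E n × S n =>
      minEnergy f ε p (boundaryDatum w ε z.1 z.2) (cube R z.2 ρ z.1) :=
  measurable_of_prod_union_cover measurableSet_hemispherePos measurableSet_hemisphereNeg
    mem_hemispherePos_or_mem_hemisphereNeg
    (upperSemicontinuous_minEnergy hR hR.continuousOn_pos hρ hε hw hW hp hc₂ hf).measurable
    (upperSemicontinuous_minEnergy hR hR.continuousOn_neg hρ hε hw hW hp hc₂ hf).measurable

/-- If a function grows at most like `C ρ ^ m`, then the upper limit of its quotient by `ρ ^ m` as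
`ρ → 0⁺` may be taken along the rational numbers. -/
theorem limsup_nhdsGT_eq_iInf_iSup_rat {Q : ℝ → ℝ≥0∞} {C : ℝ} {m : ℕ}
    (hQ : ∀ r ρ, 0 < r → r < ρ → Q ρ ≤ Q r + ENNReal.ofReal (C * (ρ ^ m - r ^ m))) :
    limsup (fun ρ : ℝ => ENNReal.ofReal (1 / ρ ^ m) * Q ρ) (𝓝[>] 0) =
      ⨅ k : ℕ, ⨆ q : ℚ, ⨆ _ : 0 < (q : ℝ) ∧ (q : ℝ) < 1 / ((k : ℝ) + 1),
        ENNReal.ofReal (1 / (q : ℝ) ^ m) * Q q := by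
  rw [(nhdsGT_basis (0 : ℝ)).limsup_eq_iInf_iSup]
  refine le_antisymm (le_iInf fun k => ?_) (le_iInf₂ fun b hb => ?_)
  · refine iInf₂_le_of_le (1 / ((k : ℝ) + 1)) (by positivity) (iSup₂_le fun ρ hρ => ?_)
    have hρ0 : 0 < ρ := hρ.1
    refine ENNReal.le_of_forall_pos_le_add fun δ hδ _ => ?_
    have hδ' : (0 : ℝ) < δ := hδ
    -- A rational number slightly smaller than `ρ` gives almost the same quotient.
    obtain ⟨q, hq0, hqρ, hq⟩ : ∃ q : ℚ, 0 < (q : ℝ) ∧ (q : ℝ) < ρ ∧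
        1 / ρ ^ m * (C * (ρ ^ m - (q : ℝ) ^ m)) ≤ δ := by
      have hc : Continuous fun r : ℝ => 1 / ρ ^ m * (C * (ρ ^ m - r ^ m)) := by fun_prop
      have hev : ∀ᶠ r in 𝓝[<] ρ, 1 / ρ ^ m * (C * (ρ ^ m - r ^ m)) < δ :=
        (hc.continuousAt.eventually_lt_const (by simpa using hδ')).filter_mono nhdsWithin_le_nhds
      have hev2 : ∀ᶠ r in 𝓝[<] ρ, r ∈ Set.Ioo 0 ρ := Ioo_mem_nhdsLT hρ0
      obtain ⟨a, haρ, ha⟩ := (mem_nhdsLT_iff_exists_Ioo_subset' hρ0).1 (hev.and hev2)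
      obtain ⟨q, hq1, hq2⟩ := exists_rat_btwn (Set.mem_Iio.1 haρ)
      obtain ⟨h1, h2⟩ := ha ⟨hq1, hq2⟩
      exact ⟨q, h2.1, h2.2, h1.le⟩
    have hqm : (q : ℝ) ^ m ≤ ρ ^ m := by gcongr
    calc ENNReal.ofReal (1 / ρ ^ m) * Q ρ
        ≤ ENNReal.ofReal (1 / ρ ^ m) *
            (Q q + ENNReal.ofReal (C * (ρ ^ m - (q : ℝ) ^ m))) := by
          gcongr; exact hQ _ _ hq0 hqρ
      _ = ENNReal.ofReal (1 / ρ ^ m) * Q q +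
            ENNReal.ofReal (1 / ρ ^ m * (C * (ρ ^ m - (q : ℝ) ^ m))) := by
          rw [mul_add, ← ENNReal.ofReal_mul (by positivity)]
      _ ≤ ENNReal.ofReal (1 / (q : ℝ) ^ m) * Q q + δ := by
          gcongr
          exact ENNReal.ofReal_le_of_le_toReal (by simpa using hq)
      _ ≤ _ := by
          gcongr
          exact le_iSup₂_of_le q ⟨hq0, hqρ.trans hρ.2⟩ le_rfl
  · obtain ⟨k, hk⟩ := exists_nat_one_div_lt hb
    refine iInf_le_of_le k (iSup_le fun q => iSup_le fun hq => ?_)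
    exact le_iSup₂_of_le (f := fun ρ (_ : ρ ∈ Set.Ioo 0 b) => ENNReal.ofReal (1 / ρ ^ m) * Q ρ)
      (q : ℝ) ⟨hq.1, hq.2.trans hk⟩ le_rfl

end PhaseTransition

end

open PhaseTransition in
theorem proposition6p2 (n : ℕ) (hn : 2 ≤ n) (p c₁ c₂ : ℝ) (hp : 1 < p) (hc₁ : 0 < c₁)
    (hc₂ : c₁ ≤ c₂) (W : ℝ → ℝ) (hW : PhaseTransition.IsDoubleWell W)
    (R : PhaseTransition.S n → Matrix (Fin n) (Fin n) ℝ)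
    (hR : PhaseTransition.IsRotationFamily n R)
    (w : ℝ → ℝ) (hw : PhaseTransition.IsProfile w)
    (ε : ℕ → ℝ) (hε : ∀ k, ε k ∈ Set.Ioc (0 : ℝ) 1) (hε_anti : Antitone ε)
    (hε_lim : Tendsto ε atTop (𝓝 0))
    (f : ℕ → PhaseTransition.E n → ℝ → PhaseTransition.E n → ℝ)
    (hf : ∀ k, PhaseTransition.IsIntegrand W p c₁ c₂ (f k)) :
    (Measurable fun z : PhaseTransition.E n × PhaseTransition.S n =>
      PhaseTransition.fLower f ε p w R z.1 z.2) ∧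
    (Measurable fun z : PhaseTransition.E n × PhaseTransition.S n =>
      PhaseTransition.fUpper f ε p w R z.1 z.2) ∧
    ∀ (x : PhaseTransition.E n) (ν : PhaseTransition.S n),
      (ENNReal.ofReal (c₁ * PhaseTransition.surfaceTension W p) ≤
          PhaseTransition.fLower f ε p w R x ν ∧
        PhaseTransition.fLower f ε p w R x ν ≤
          ENNReal.ofReal (c₂ * PhaseTransition.surfaceTension W p)) ∧
      (ENNReal.ofReal (c₁ * PhaseTransition.surfaceTension W p) ≤
          PhaseTransition.fUpper f ε p w R x ν ∧
        PhaseTransition.fUpper f ε p w R x ν ≤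
          ENNReal.ofReal (c₂ * PhaseTransition.surfaceTension W p)) := by
  have hn0 : 0 < n := by omega
  have hc₂0 : 0 ≤ c₂ := hc₁.le.trans hc₂
  have hw1 := hw.isTransition
  have hcell : ∀ (k : ℕ) (ρ : ℝ), 0 < ρ → Measurable fun z : E n × S n =>
      cellMin f ε p w R k ρ z.1 z.2 := fun k ρ hρ =>
    measurable_minEnergy hR hρ (hε k).1 hw1 hW hp hc₂0 (hf k)
  have hsmall : ∀ a : ℝ, 0 < a → ∀ᶠ k in atTop, ε k < a := fun a ha =>
    hε_lim.eventually_lt_const ha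
  -- Growth of the cell minima with respect to the size of the cube.
  have hgrow : ∀ (x : E n) (ν : S n), ∃ C, ∀ r ρ : ℝ, 0 < r → r < ρ → ∀ᶠ k in atTop,
      cellMin f ε p w R k ρ x ν ≤ cellMin f ε p w R k r x ν +
        ENNReal.ofReal (C * (ρ ^ (n - 1) - r ^ (n - 1))) := by
    intro x ν
    obtain ⟨C, h⟩ := exists_minEnergy_cube_le (c₁ := c₁) hn0 hR ν x hw1 hW hp hc₂0
    refine ⟨C, fun r ρ hr hrρ => ?_⟩
    filter_upwards [hsmall (r / 2) (by positivity)] with k hk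
    exact h r ρ (ε k) hr hrρ (hε k).1 hk (f k) (hf k)
  have hlower : ∀ z : E n × S n, fLower f ε p w R z.1 z.2 =
      ⨅ k : ℕ, ⨆ q : ℚ, ⨆ _ : 0 < (q : ℝ) ∧ (q : ℝ) < 1 / ((k : ℝ) + 1),
        ENNReal.ofReal (1 / (q : ℝ) ^ (n - 1)) *
          liminf (fun k : ℕ => cellMin f ε p w R k q z.1 z.2) atTop := fun z => by
    obtain ⟨C, h⟩ := hgrow z.1 z.2
    refine limsup_nhdsGT_eq_iInf_iSup_rat (C := C) fun r ρ hr hrρ => ?_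
    exact (liminf_le_liminf (h r ρ hr hrρ)).trans_eq
      (liminf_add_const _ _ _ (by isBoundedDefault) (by isBoundedDefault))
  have hupper : ∀ z : E n × S n, fUpper f ε p w R z.1 z.2 =
      ⨅ k : ℕ, ⨆ q : ℚ, ⨆ _ : 0 < (q : ℝ) ∧ (q : ℝ) < 1 / ((k : ℝ) + 1),
        ENNReal.ofReal (1 / (q : ℝ) ^ (n - 1)) *
          limsup (fun k : ℕ => cellMin f ε p w R k q z.1 z.2) atTop := fun z => by
    obtain ⟨C, h⟩ := hgrow z.1 z.2
    refine limsup_nhdsGT_eq_iInf_iSup_rat (C := C) fun r ρ hr hrρ => ?_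
    exact (limsup_le_limsup (h r ρ hr hrρ)).trans_eq
      (limsup_add_const _ _ _ (by isBoundedDefault) (by isBoundedDefault))
  have hle : ∀ (x : E n) (ν : S n), fLower f ε p w R x ν ≤ fUpper f ε p w R x ν := fun x ν =>
    limsup_le_limsup (Eventually.of_forall fun ρ => by dsimp only; gcongr; exact liminf_le_limsup)
  have hlo : ∀ (x : E n) (ν : S n),
      ENNReal.ofReal (c₁ * surfaceTension W p) ≤ fLower f ε p w R x ν := by
    intro x ν
    refine le_limsup_of_frequently_le (Eventually.frequently ?_) (by isBoundedDefault)
    filter_upwards [self_mem_nhdsWithin] with ρ hρ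
    have hρ0 : 0 < ρ := hρ
    have h1 : ENNReal.ofReal (c₁ * surfaceTension W p * ρ ^ (n - 1)) ≤
        liminf (fun k : ℕ => cellMin f ε p w R k ρ x ν) atTop := by
      refine le_liminf_of_le (by isBoundedDefault) ?_
      filter_upwards [hsmall (ρ / 2) (by positivity)] with k hk
      exact le_minEnergy hn0 hR ν hρ0 (hε k).1 (by linarith) x hw1 hW hp hc₁.le (hf k)
    refine le_trans (le_of_eq ?_) (mul_le_mul_right h1 (ENNReal.ofReal (1 / ρ ^ (n - 1))))
    rw [← ENNReal.ofReal_mul (by positivity)]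
    congr 1; field_simp
  have hup : ∀ (x : E n) (ν : S n),
      fUpper f ε p w R x ν ≤ ENNReal.ofReal (c₂ * surfaceTension W p) := by
    intro x ν
    have hδ : ∀ δ : ℝ, 0 < δ → fUpper f ε p w R x ν ≤
        ENNReal.ofReal (c₂ * (surfaceTension W p + δ) + δ) := by
      intro δ hδ
      refine limsup_le_of_le (by isBoundedDefault) ?_
      filter_upwards [self_mem_nhdsWithin] with ρ hρ
      have hρ0 : 0 < ρ := hρ
      obtain ⟨ε₀, hε₀, h⟩ := exists_forall_minEnergy_le (c₁ := c₁) hn0 hR ν hρ0 x hw1 hW hp hc₂0 hδ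
      have h1 : limsup (fun k : ℕ => cellMin f ε p w R k ρ x ν) atTop ≤
          ENNReal.ofReal ((c₂ * (surfaceTension W p + δ) + δ) * ρ ^ (n - 1)) := by
        refine limsup_le_of_le (by isBoundedDefault) ?_
        filter_upwards [hsmall ε₀ hε₀] with k hk
        exact h (ε k) (hε k).1 hk (f k) (hf k)
      refine (mul_le_mul_right h1 (ENNReal.ofReal (1 / ρ ^ (n - 1)))).trans (le_of_eq ?_)
      rw [← ENNReal.ofReal_mul (by positivity)]
      congr 1; field_simp
    have hc : Continuous fun δ : ℝ => ENNReal.ofReal (c₂ * (surfaceTension W p + δ) + δ) :=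
      ENNReal.continuous_ofReal.comp (by fun_prop)
    have hlim : Tendsto (fun δ : ℝ => ENNReal.ofReal (c₂ * (surfaceTension W p + δ) + δ))
        (𝓝[>] 0) (𝓝 (ENNReal.ofReal (c₂ * surfaceTension W p))) := by
      have := (hc.tendsto 0).mono_left (nhdsWithin_le_nhds (s := Set.Ioi 0))
      simpa using this
    refine ge_of_tendsto hlim ?_
    filter_upwards [self_mem_nhdsWithin] with δ hδ' using hδ δ hδ'
  refine ⟨?_, ?_, fun x ν => ⟨⟨hlo x ν, (hle x ν).trans (hup x ν)⟩,
    (hlo x ν).trans (hle x ν), hup x ν⟩⟩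
  · simp only [hlower]
    exact .iInf fun k => .iSup fun q => .iSup fun hq =>
      (Measurable.liminf fun k => hcell k q hq.1).const_mul _
  · simp only [hupper]
    exact .iInf fun k => .iSup fun q => .iSup fun hq =>
      (Measurable.limsup fun k => hcell k q hq.1).const_mul _
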